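/- Let $N, N'$ be integers with $2 \le N' \le N-2$. For a lower triangular matrix $H=(h_{i,j}) \in \mathbb{R}^{(N-1)\times(N-1)}$ and $1\le m, j\le N-1$ put $$P(N-1,m;H)=\sum \prod_{r=1}^m h_{i(r),j(r)},$$ the sum being over all integers $1\le j(1)\le i(1)<j(2)\le i(2)<\cdots<j(m)\le i(m)\le N-1$, and let $Q(N-1,m,j;H)$ be the part of this sum with $j(1)=j$. We say that $H$ satisfies *H-invariance* if $P(N-1,m;H)=\frac1N\binom{N}{m+1}$ for $m=1,\dots,N-1$. For formal vectors $y_0,g_1,\dots,g_N$ put $y_{k}=y_{k-1}-\sum_{j=1}^{k}2h_{k,j}g_j$ ($1\le k\le N-1$) and $x_k=y_{k-1}-g_k$ ($1\le k\le N$). Under H-invariance the *H-certificates* $\lambda^\star_{k,j}(H)$, $1\le j<k\le N$, are the values of $\lambda_{k,j}$ (which exist and are unique) for which $$0=N\|g_N\|^2+\langle g_N,x_N-y_0\rangle+\sum_{k=1}^N\sum_{j=1}^{k-1}\lambda_{k,j}\langle x_k-x_j,g_k-g_j\rangle$$ holds identically in $y_0,g_1,\dots,g_N$ (in every $\mathbb{R}^d$).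 *Bottom-sparsity* at $j$ means $\lambda^\star_{j+1,j}=\cdots=\lambda^\star_{N-1,j}=0$; *top-sparsity* at $j$ means $\lambda^\star_{j+2,j}=\cdots=\lambda^\star_{N,j}=0$. **Proposition.** A lower triangular $H$ satisfies H-invariance together with bottom-sparsity at $j=1,\dots,N'-1$ and top-sparsity at $j=N',\dots,N-1$ if and only if, for all $j=1,\dots,N-1$ and $k=1,\dots,N-j$, $$Q(N-1,k,j;H)=\begin{cases}\frac{1}{k+1}\binom{N-j-1}{k-1}, & j\le N'-1,\\[2pt] \frac{j-N'+1}{N-N'+1}\binom{N-j-1}{k-1}, & j\ge N'.\end{cases}$$ There is exactly one lower triangular $H$ with these Q-function values. For this $H$ we have $\lambda^\star_{N,j}>0$ for $j=1,\dots,N'-1$ and $\lambda^\star_{j+1,j}>0$ for $j=N',\dots,N-1$, and the algorithm $y_{k+1}=y_k-\sum_{j=0}^k h_{k+1,j+1}(y_j-Ty_j)$ ($k=0,\dots,N-2$) is minimax optimal: for every $d$, every nonexpansive $T:\mathbb{R}^d\to\mathbb{R}^d$, every fixed point $y_\star$ of $T$ and every $y_0$, $$\|y_{N-1}-Ty_{N-1}\|^2\le\frac{4\|y_0-y_\star\|^2}{N^2},$$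 and for every $d\ge 2(N-1)$ the supremum of $\|y_{N-1}-Ty_{N-1}\|^2/\|y_0-y_\star\|^2$ over all nonexpansive $T$ on $\mathbb{R}^d$, fixed points $y_\star$ of $T$ and $y_0\ne y_\star$ equals $4/N^2$ and is the least one among all deterministic algorithms, i.e. those in which $y_{k+1}$ is an arbitrary function of $y_0,\dots,y_k,Ty_0,\dots,Ty_k$. -/

import Mathlib

open Finset
open scoped ENNReal

noncomputable section

namespace HMatrix

/-- The entry `h_{i,j}` of a square matrix in one-based indexing; it is `0` outside the matrix. -/
def entry {n : ℕ} (H : Matrix (Fin n) (Fin n) ℝ) (i j : ℕ) : ℝ :=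
  if h : (1 ≤ i ∧ i ≤ n) ∧ (1 ≤ j ∧ j ≤ n) then
    H ⟨i - 1, by omega⟩ ⟨j - 1, by omega⟩
  else 0

/-- `H` is lower triangular (the diagonal is included). -/
def LowerTriangular {n : ℕ} (H : Matrix (Fin n) (Fin n) ℝ) : Prop :=
  ∀ i j, i < j → H i j = 0

/-- The sequences `((i(1), j(1)), …, (i(m), j(m)))` of elements of `{1, …, k} × {1, …, k}` with
`j(1) ≤ i(1) < j(2) ≤ i(2) < ⋯ < j(m) ≤ i(m) ≤ k`.  The `r`-th pair is `p r = (i, j)`,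
with `r` counted from zero. -/
def indexSet (k m : ℕ) : Finset (Fin m → ℕ × ℕ) :=
  (Fintype.piFinset fun _ : Fin m => Icc 1 k ×ˢ Icc 1 k).filter fun p =>
    (∀ r, (p r).2 ≤ (p r).1) ∧ ∀ r s : Fin m, (s : ℕ) = (r : ℕ) + 1 → (p r).1 < (p s).2

/-- `P(k, m; H)`, with `P(k, 0; H) = 1`. -/
def P {n : ℕ} (H : Matrix (Fin n) (Fin n) ℝ) (k m : ℕ) : ℝ :=
  ∑ p ∈ indexSet k m, ∏ r, entry H (p r).1 (p r).2

/-- `Q(k, m, j; H)`: the part of the sum defining `P(k, m; H)` with smallest column index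
`j(1) = j`, for `m ≥ 1`. -/
def Q {n : ℕ} (H : Matrix (Fin n) (Fin n) ℝ) (k m j : ℕ) : ℝ :=
  ∑ p ∈ (indexSet k m).filter (fun p => ∃ h : 0 < m, (p ⟨0, h⟩).2 = j),
    ∏ r, entry H (p r).1 (p r).2

/-- The H-invariance conditions `P(N-1, m; H) = (1/N) * binom(N, m+1)`, `m = 1, …, N-1`. -/
def HInvariance (N : ℕ) (H : Matrix (Fin (N - 1)) (Fin (N - 1)) ℝ) : Prop :=
  ∀ m, 1 ≤ m → m ≤ N - 1 → P H (N - 1) m = 1 / (N : ℝ) * (N.choose (m + 1) : ℝ)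

/-! ### H-certificates -/

section Certificates

variable {V : Type*} [NormedAddCommGroup V] [InnerProductSpace ℝ V]

/-- `y_0` is given and `y_{k+1} = y_k - ∑_{j=1}^{k+1} 2 h_{k+1,j} g_j`, for formal vector variables
`g_1, g_2, …`. -/
def yVec {n : ℕ} (H : Matrix (Fin n) (Fin n) ℝ) (y₀ : V) (g : ℕ → V) : ℕ → V
  | 0 => y₀
  | k + 1 => yVec H y₀ g k - ∑ j ∈ Icc 1 (k + 1), (2 * entry H (k + 1) j) • g j

/-- `x_k = y_{k-1} - g_k` for `k ≥ 1`. -/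
def xVec {n : ℕ} (H : Matrix (Fin n) (Fin n) ℝ) (y₀ : V) (g : ℕ → V) (k : ℕ) : V :=
  yVec H y₀ g (k - 1) - g k

end Certificates

/-- `lam` solves the defining equation of the H-certificates, i.e.
`0 = N ‖g_N‖² + ⟪g_N, x_N - y_0⟫ + ∑_{1 ≤ j < k ≤ N} lam_{k,j} ⟪x_k - x_j, g_k - g_j⟫`
is an identity in the vectors `y_0, g_1, …, g_N` (of any Euclidean space). Only the entries with
`1 ≤ j < k ≤ N` are meaningful; the others are normalised to `0`. -/
def IsCertificate (N : ℕ) (H : Matrix (Fin (N - 1)) (Fin (N - 1)) ℝ) (lam : ℕ → ℕ → ℝ) : Prop :=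
  (∀ k j, ¬ (1 ≤ j ∧ j < k ∧ k ≤ N) → lam k j = 0) ∧
  ∀ (d : ℕ) (y₀ : EuclideanSpace ℝ (Fin d)) (g : ℕ → EuclideanSpace ℝ (Fin d)),
    0 = (N : ℝ) * ‖g N‖ ^ 2 + inner ℝ (g N) (xVec H y₀ g N - y₀)
      + ∑ k ∈ Icc 1 N, ∑ j ∈ Ico 1 k,
          lam k j * inner ℝ (xVec H y₀ g k - xVec H y₀ g j) (g k - g j)

open Classical in
/-- The H-certificates `λ*_{k,j}(H)`: the solution of the defining equation (and `0` if there is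
none). -/
def certificate (N : ℕ) (H : Matrix (Fin (N - 1)) (Fin (N - 1)) ℝ) : ℕ → ℕ → ℝ :=
  if h : ∃ lam, IsCertificate N H lam then h.choose else fun _ _ => 0

/-- Bottom-sparsity at `j`: `λ*_{j+1,j} = ⋯ = λ*_{N-1,j} = 0`. -/
def BottomSparse (N : ℕ) (H : Matrix (Fin (N - 1)) (Fin (N - 1)) ℝ) (j : ℕ) : Prop :=
  ∀ k, j + 1 ≤ k → k ≤ N - 1 → certificate N H k j = 0

/-- Top-sparsity at `j`: `λ*_{j+2,j} = ⋯ = λ*_{N,j} = 0`. -/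
def TopSparse (N : ℕ) (H : Matrix (Fin (N - 1)) (Fin (N - 1)) ℝ) (j : ℕ) : Prop :=
  ∀ k, j + 2 ≤ k → k ≤ N → certificate N H k j = 0

/-! ### Fixed-point algorithms and minimax optimality -/

/-- A deterministic algorithm on `ℝ^d` using evaluations of an operator `T`: the next iterate
`y_{k+1}` is an arbitrary function of `y_0, …, y_k` and of `T y_0, …, T y_k`. -/
abbrev Algorithm (d : ℕ) : Type :=
  (k : ℕ) → (Fin (k + 1) → EuclideanSpace ℝ (Fin d)) → (Fin (k + 1) → EuclideanSpace ℝ (Fin d)) →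
    EuclideanSpace ℝ (Fin d)

/-- The iterates of an algorithm applied to `T` from the starting point `y₀`. -/
def iter {d : ℕ} (A : Algorithm d) (T : EuclideanSpace ℝ (Fin d) → EuclideanSpace ℝ (Fin d))
    (y₀ : EuclideanSpace ℝ (Fin d)) : ℕ → EuclideanSpace ℝ (Fin d)
  | 0 => y₀
  | k + 1 => A k (fun i => iter A T y₀ i.val) (fun i => T (iter A T y₀ i.val))
  termination_by k => k
  decreasing_by all_goals exact i.isLt

/-- The algorithm `y_{k+1} = y_k - ∑_{j=0}^k h_{k+1,j+1} (y_j - T y_j)` represented by `H`. -/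
def toAlgorithm {n : ℕ} (H : Matrix (Fin n) (Fin n) ℝ) (d : ℕ) : Algorithm d :=
  fun k y Ty => y (Fin.last k) - ∑ j : Fin (k + 1), entry H (k + 1) (j.val + 1) • (y j - Ty j)

/-- The worst case, over all nonexpansive `T : ℝ^d → ℝ^d`, fixed points `y⋆` of `T` and starting
points `y₀ ≠ y⋆`, of `‖y_{N-1} - T y_{N-1}‖² / ‖y₀ - y⋆‖²`. -/
def worstCase {d : ℕ} (N : ℕ) (A : Algorithm d) : ℝ≥0∞ :=
  ⨆ (T : EuclideanSpace ℝ (Fin d) → EuclideanSpace ℝ (Fin d)) (y₀ : EuclideanSpace ℝ (Fin d))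
    (ystar : EuclideanSpace ℝ (Fin d)) (_ : LipschitzWith 1 T) (_ : T ystar = ystar)
    (_ : y₀ ≠ ystar),
    ENNReal.ofReal
      (‖iter A T y₀ (N - 1) - T (iter A T y₀ (N - 1))‖ ^ 2 / ‖y₀ - ystar‖ ^ 2)

/-- `A`, run for `N - 1` operator evaluations, is minimax optimal: its worst case is the least one
among all deterministic algorithms on `ℝ^d`. -/
def IsMinimaxOptimal {d : ℕ} (N : ℕ) (A : Algorithm d) : Prop :=
  ∀ B : Algorithm d, worstCase N A ≤ worstCase N B

/-! ### The Q-function profile -/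

/-- `binom(N-j-1, k-1) / (k+1)` for `j < N'` and
`(j-N'+1)/(N-N'+1) * binom(N-j-1, k-1)` for `j ≥ N'`. -/
def profile (N N' k j : ℕ) : ℝ :=
  if j < N' then 1 / ((k : ℝ) + 1) * ((N - j - 1).choose (k - 1) : ℝ)
  else ((j : ℝ) - N' + 1) / ((N : ℝ) - N' + 1) * ((N - j - 1).choose (k - 1) : ℝ)

/-- The Q-functions `Q(N-1, k, j; H)` have the values `profile N N' k j`
for `j = 1, …, N-1` and `k = 1, …, N-j`. -/
def HasProfile (N N' : ℕ) (H : Matrix (Fin (N - 1)) (Fin (N - 1)) ℝ) : Prop :=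
  ∀ j, 1 ≤ j → j ≤ N - 1 → ∀ k, 1 ≤ k → k ≤ N - j → Q H (N - 1) k j = profile N N' k j

end HMatrix

end

/-!
Let `K` be the strictly lower triangular matrix of column sums `K_{k,j} = h_{j,j} + ⋯ + h_{k-1,j}`
(`colSum`), so that `y_0 - x_k = g_k + 2 ∑_j K_{k,j} g_j`. Splitting off the first factor of the
products in `Q(N-1, a, j; H)` shows that the vectors `q_a = (Q(N-1, a, j; H))_j` are the powers of
`Kᵀ` applied to the last basis vector `e_N` (`qVec_succ_eq_Q`), and that `P(N-1, a; H)` is the sum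
of the coordinates of `q_a`.

The certificates, written as a Laplacian matrix `S`, have to satisfy the Lyapunov equation `S' (I +
2K) + (I + 2K)ᵀ S' = 2N e_N e_Nᵀ` for `S' = S + e_N e_Nᵀ`. As `K` is nilpotent, its solution is
unique (`eq_zero_of_lyapunov`), and Pascal's rule shows that it is `S' = N ∑_{a,b} (-1)^(a+b)
binom(a+b, a) q_a q_bᵀ` (`certMatrix`, `sum_certMatrix_mul`). The remaining condition, that `S` has
zero row sums, follows from H-invariance, since finite differences of order `N` annihilate
polynomials of smaller degree (`sum_certMatrix`). This gives a closed formula for the certificates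
(`certificate_eq_certFormula`).

Column `j` of the certificates depends on column `j` of the Q-functions through the sums `R_a = ∑_b
(-1)^b binom(a+b, a) Q(N-1, b, j; H)` (`altPairing`). The border entries `Q(N-1, N-k, k; H)` are
nonzero, so the sparsity conditions successively say that `R_a = 0` for `N-j-1` values of `a`. For
`Q = binom(N-j-1, b-1)` and `Q = binom(N-j-1, b-1) / (b+1)` these sums are finite differences of
polynomials of too small a degree, and there are no other solutions up to scaling, because a
polynomial of degree at most `n` with `n + 1` roots is zero (`eq_zero_of_sum_choose_eq_zero`). The
scales are then determined by H-invariance (`scale_unique`); that the profile has the right total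
mass is a hockey-stick identity (`sum_profile`). A lower triangular matrix is recovered from its
Q-functions by forward substitution (`existsUnique_hasProfile`).

Nonnegative certificates give the rate: substituting `g_k = (y_{k-1} - T y_{k-1}) / 2` in the
defining equation leaves `N ‖g_N‖² ≤ ⟪g_N, y_0 - y⋆⟫` (`residual_le_of_certificate`). For the
matching lower bound, `T` is an affine isometry whose linear part is a signed cyclic shift of
orthonormal vectors `v_0, …, v_{N-1}`, which are chosen one by one, orthogonal to the queries made
so far (`le_worstCase`).
-/

namespace HMatrix

/-! ### Alternating binomial sums -/

/-- Pascal's rule for the `n`-th finite difference of a sequence. -/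
lemma alternating_sum_succ (n : ℕ) (f : ℕ → ℝ) :
    ∑ c ∈ range (n + 2), (-1) ^ c * ((n + 1).choose c : ℝ) * f c
      = ∑ c ∈ range (n + 1), (-1) ^ c * (n.choose c : ℝ) * (f c - f (c + 1)) := by
  have h1 : ∑ c ∈ range (n + 1), (-1 : ℝ) ^ c * (n.choose c : ℝ) * f c
      = f 0 + ∑ c ∈ range (n + 1), (-1) ^ (c + 1) * (n.choose (c + 1) : ℝ) * f (c + 1) := by
    rw [sum_range_succ', sum_range_succ (fun c => (-1) ^ (c + 1) * (n.choose (c + 1) : ℝ) * _)]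
    simp [add_comm]
  rw [sum_range_succ']
  simp only [mul_sub, sum_sub_distrib, h1, Nat.choose_succ_succ]
  rw [add_sub_assoc, ← sum_sub_distrib, add_comm]
  congr 1
  · simp
  · refine sum_congr rfl fun c _ => ?_
    push_cast
    ring

lemma alternating_sum_choose (n a x : ℕ) :
    ∑ c ∈ range (n + 1), (-1) ^ c * (n.choose c : ℝ) * ((c + x).choose (a + n) : ℝ)
      = (-1) ^ n * (x.choose a : ℝ) := by
  induction n with
  | zero => simp
  | succ n ih =>
    rw [alternating_sum_succ, pow_succ, mul_right_comm, ← ih, sum_mul]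
    refine sum_congr rfl fun c _ => ?_
    rw [show c + 1 + x = c + x + 1 by ring, ← add_assoc, Nat.choose_succ_succ]
    push_cast
    ring

lemma alternating_sum_choose_eq_zero {n a : ℕ} (h : a < n) (x : ℕ) :
    ∑ c ∈ range (n + 1), (-1) ^ c * (n.choose c : ℝ) * ((c + x).choose a : ℝ) = 0 := by
  induction n generalizing a with
  | zero => omega
  | succ n ih =>
    rw [alternating_sum_succ]
    cases a with
    | zero => simp
    | succ a =>
      rw [← neg_eq_zero, ← ih (Nat.lt_of_succ_lt_succ h), ← sum_neg_distrib]
      refine sum_congr rfl fun c _ => ?_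
      rw [show c + 1 + x = c + x + 1 by ring, Nat.choose_succ_succ]
      push_cast
      ring

lemma alternating_sum_inv (n x : ℕ) :
    ∑ c ∈ range (n + 1), (-1) ^ c * (n.choose c : ℝ) * (1 / ((c : ℝ) + x + 1))
      = (n.factorial * x.factorial : ℝ) / (n + x + 1).factorial := by
  induction n generalizing x with
  | zero => simp [Nat.factorial_succ]; field_simp
  | succ n ih =>
    rw [alternating_sum_succ]
    simp only [mul_sub, sum_sub_distrib]
    have h := ih (x + 1)
    rw [ih x]
    rw [show (∑ c ∈ range (n + 1), (-1) ^ c * (n.choose c : ℝ) * (1 / (((c + 1 : ℕ) : ℝ) + x + 1)))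
      = ∑ c ∈ range (n + 1), (-1) ^ c * (n.choose c : ℝ) * (1 / ((c : ℝ) + (x + 1 : ℕ) + 1)) from
      sum_congr rfl fun c _ => by push_cast; ring_nf, h]
    rw [show n + (x + 1) + 1 = (n + x + 1) + 1 by ring,
      show n + 1 + x + 1 = (n + x + 1) + 1 by ring]
    have h1 : ((n + x + 1).factorial : ℝ) ≠ 0 := by positivity
    rw [Nat.factorial_succ (n + x + 1), Nat.factorial_succ n, Nat.factorial_succ x]
    push_cast
    field_simp
    ring

/-- The orthogonality relation behind the zero row sums of the certificate matrix. -/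
lemma alternating_sum_choose_mul_choose_succ {N a : ℕ} (ha : a < N) :
    ∑ b ∈ range N, (-1) ^ (a + b) * ((a + b).choose a : ℝ) * (N.choose (b + 1) : ℝ)
      = if a = 0 then 1 else 0 := by
  cases a with
  | zero =>
    have h := alternating_sum_choose_eq_zero ha 0
    rw [sum_range_succ'] at h
    simp only [Nat.choose_zero_right, pow_succ] at h
    simp only [zero_add, Nat.choose_zero_right, if_true]
    have h2 : ∑ b ∈ range N, (-1) ^ b * (((1 : ℕ) : ℕ) : ℝ) * (N.choose (b + 1) : ℝ)
        = -∑ k ∈ range N, (-1 : ℝ) ^ k * -1 * (N.choose (k + 1)) * ((1 : ℕ) : ℝ) := by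
      rw [← sum_neg_distrib]
      exact sum_congr rfl fun _ _ => by push_cast; ring
    rw [h2]
    norm_num at h ⊢
    linarith
  | succ a =>
    have h := alternating_sum_choose_eq_zero ha a
    rw [sum_range_succ'] at h
    simp only [Nat.choose_succ_self, zero_add, Nat.cast_zero, mul_zero, add_zero] at h
    rw [if_neg (by omega), ← mul_zero ((-1 : ℝ) ^ a), ← h, mul_sum]
    refine sum_congr rfl fun b _ => ?_
    rw [show a + 1 + b = b + 1 + a by ring]
    ring

/-- A vector indexed by `1, …, n` is determined by its pairings with the vectors
`b ↦ binom(a+b, a)` for any `n` different `a`: the pairing is `p (a + 1)` for a polynomial `p` of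
degree at most `n` that also has the root `0`. -/
lemma eq_zero_of_sum_choose_eq_zero {n : ℕ} {z : ℕ → ℝ} (s : Finset ℕ) (hs : n ≤ s.card)
    (h : ∀ a ∈ s, ∑ b ∈ Icc 1 n, z b * ((a + b).choose a : ℝ) = 0) :
    ∀ b ∈ Icc 1 n, z b = 0 := by
  set p : Polynomial ℝ :=
    ∑ b ∈ Icc 1 n, Polynomial.C (z b / b.factorial) * ascPochhammer ℝ b with hp
  have heval (t : ℝ) : p.eval t
      = ∑ b ∈ Icc 1 n, z b / b.factorial * (ascPochhammer ℝ b).eval t := by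
    simp [hp, Polynomial.eval_finsetSum]
  have hp0 : p = 0 := by
    refine Polynomial.eq_zero_of_natDegree_lt_card_of_eval_eq_zero' p
      (insert 0 (s.image fun a : ℕ => (a : ℝ) + 1)) ?_ ?_
    · intro t ht
      rw [heval]
      rcases mem_insert.1 ht with rfl | ht
      · refine sum_eq_zero fun b hb => ?_
        rw [ascPochhammer_eval_zero, if_neg (by have := mem_Icc.1 hb; omega), mul_zero]
      · obtain ⟨a, ha, rfl⟩ := mem_image.1 ht
        rw [← h a ha]
        refine sum_congr rfl fun b _ => ?_
        have h1 : (ascPochhammer ℝ b).eval ((a : ℝ) + 1) = (b.factorial * (a + b).choose a : ℕ) := by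
          rw [show (a : ℝ) + 1 = ((a + 1 : ℕ) : ℝ) by push_cast; ring, ← ascPochhammer_eval_cast,
            ascPochhammer_nat_eq_ascFactorial, Nat.ascFactorial_eq_factorial_mul_choose,
            Nat.choose_symm_add]
        rw [h1]
        push_cast
        field_simp
    · rw [card_insert_of_notMem, card_image_of_injective]
      · refine Nat.lt_succ_of_le (le_trans ?_ hs)
        refine Polynomial.natDegree_sum_le_of_forall_le _ _ fun b hb => ?_
        refine (Polynomial.natDegree_C_mul_le _ _).trans ?_
        rw [ascPochhammer_natDegree]
        exact (mem_Icc.1 hb).2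
      · intro a b hab
        simpa using hab
      · rw [mem_image]
        rintro ⟨a, -, ha⟩
        have h0 : (0 : ℝ) ≤ a := a.cast_nonneg
        linarith
  intro b
  induction b using Nat.strong_induction_on with
  | _ b ih =>
    intro hb
    have hb1 := (mem_Icc.1 hb).1
    -- at `-b` the Pochhammer polynomials of degree above `b` vanish
    have h0 := heval (-(b : ℝ))
    rw [hp0, Polynomial.eval_zero, sum_eq_single_of_mem b hb] at h0
    · have h1 : (ascPochhammer ℝ b).eval (-(b : ℝ)) ≠ 0 := by
        rw [Ne, ascPochhammer_eval_eq_zero_iff]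
        rintro ⟨k, hk, hk'⟩
        rw [neg_neg, Nat.cast_inj] at hk'
        omega
      have h2 : (b.factorial : ℝ) ≠ 0 := by positivity
      simpa [h1, h2] using h0.symm
    · intro c hc hcb
      rcases lt_or_gt_of_ne hcb with hlt | hgt
      · simp [ih c hlt hc]
      · rw [ascPochhammer_eval_neg_coe_nat_of_lt hgt, mul_zero]

/-! ### The total mass of the profile -/

lemma sum_range_sub_mul_choose (M p : ℕ) :
    ∑ t ∈ range M, ((M : ℝ) - t) * (t.choose p : ℝ) = ((M + 1).choose (p + 2) : ℝ) := by
  have hockey (L : ℕ) : ∑ t ∈ range L, (t.choose p : ℝ) = (L.choose (p + 1) : ℝ) := by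
    induction L with
    | zero => simp
    | succ L ih => rw [sum_range_succ, ih, Nat.choose_succ_succ]; push_cast; ring
  induction M with
  | zero => simp [Nat.choose_eq_zero_of_lt]
  | succ M ih =>
    rw [sum_range_succ, Nat.choose_succ_succ (M + 1) (p + 1)]
    push_cast
    rw [← ih, ← hockey (M + 1), sum_range_succ, ← sub_eq_zero]
    simp only [add_sub_right_comm _ (1 : ℝ), add_mul, sum_add_distrib]
    ring_nf

lemma sum_profile {N N' : ℕ} (h1 : 1 ≤ N') (h2 : N' ≤ N) (hN : 1 ≤ N) {m : ℕ} (hm : 1 ≤ m) :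
    ∑ j ∈ Icc 1 (N - 1), profile N N' m j = 1 / (N : ℝ) * (N.choose (m + 1) : ℝ) := by
  obtain ⟨p, rfl⟩ : ∃ p, m = p + 1 := ⟨m - 1, by omega⟩
  obtain ⟨M, rfl⟩ : ∃ M, N = N' + M := ⟨N - N', by omega⟩
  have hre : ∑ j ∈ Icc 1 (N' + M - 1), profile (N' + M) N' (p + 1) j
      = ∑ t ∈ range (M + (N' - 1)), if M ≤ t then 1 / ((p : ℝ) + 2) * (t.choose p : ℝ)
          else ((M : ℝ) - t) / ((M : ℝ) + 1) * (t.choose p : ℝ) := by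
    refine sum_nbij' (fun j => N' + M - 1 - j) (fun t => N' + M - 1 - t) ?_ ?_ ?_ ?_ ?_
    · intro j hj; simp at hj ⊢; omega
    · intro j hj; simp at hj ⊢; omega
    · intro j hj; simp at hj ⊢; omega
    · intro j hj; simp at hj ⊢; omega
    · intro j hj
      simp only [mem_Icc] at hj
      unfold profile
      rw [show N' + M - j - 1 = N' + M - 1 - j by omega, Nat.add_sub_cancel]
      by_cases hlt : j < N'
      · rw [if_pos hlt, if_pos (by omega)]
        push_cast
        ring_nf
      · rw [if_neg hlt, if_neg (by omega), Nat.sub_sub, Nat.cast_sub (by omega)]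
        push_cast
        ring_nf
  have hL (i : ℕ) : (∑ t ∈ range (M + i), if M ≤ t then 1 / ((p : ℝ) + 2) * (t.choose p : ℝ)
      else ((M : ℝ) - t) / ((M : ℝ) + 1) * (t.choose p : ℝ))
      = ((M + i).choose (p + 1) : ℝ) / (p + 2) := by
    induction i with
    | zero =>
      have h3 : ∑ t ∈ range (M + 0), (if M ≤ t then 1 / ((p : ℝ) + 2) * (t.choose p : ℝ)
          else ((M : ℝ) - t) / ((M : ℝ) + 1) * (t.choose p : ℝ))
          = 1 / ((M : ℝ) + 1) * ∑ t ∈ range M, ((M : ℝ) - t) * (t.choose p : ℝ) := by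
        rw [mul_sum]
        refine sum_congr rfl fun t ht => ?_
        rw [if_neg (by simpa using ht)]
        ring
      have h4 : (((M + 1) * M.choose (p + 1) : ℕ) : ℝ)
          = ((M + 1).choose (p + 2) * (p + 2) : ℕ) :=
        congrArg _ (Nat.add_one_mul_choose_eq M (p + 1))
      push_cast at h4
      rw [h3, sum_range_sub_mul_choose, show M + 0 = M from rfl]
      field_simp
      linarith
    | succ i ih =>
      rw [← add_assoc, sum_range_succ, ih, if_pos (by omega), Nat.choose_succ_succ]
      push_cast
      ring
  rw [hre, hL]
  obtain ⟨L, hL⟩ : ∃ L, N' + M = L + 1 := ⟨N' + M - 1, by omega⟩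
  rw [show M + (N' - 1) = L by omega, hL]
  have h4 : (((L + 1) * L.choose (p + 1) : ℕ) : ℝ)
      = ((L + 1).choose (p + 2) * (p + 2) : ℕ) :=
    congrArg _ (Nat.add_one_mul_choose_eq L (p + 1))
  push_cast at h4 ⊢
  field_simp
  linarith

/-! ### The Q-functions as powers of a nilpotent matrix -/

/-- The column sums `h_{j,j} + ⋯ + h_{k-1,j}`; they are half of the entries below the diagonal of
the matrix that expresses `y_0 - x_k` through `g_1, …, g_N`. -/
def colSum {n : ℕ} (H : Matrix (Fin n) (Fin n) ℝ) (k j : ℕ) : ℝ :=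
  ∑ l ∈ Ico j k, entry H l j

/-- The Q-functions `Q(N-1, a, k; H)` in recursive form: the `k`-th coordinate of the `a`-th power
of the transpose of `colSum H`, applied to the last basis vector. For `a = 0` this is the basis
vector itself. -/
def qVec {n : ℕ} (N : ℕ) (H : Matrix (Fin n) (Fin n) ℝ) : ℕ → ℕ → ℝ
  | 0, k => if k = N then 1 else 0
  | a + 1, j => ∑ k ∈ Icc 1 N, qVec N H a k * colSum H k j

/-- The part of the sum defining `P(k, m; H)` with all column indices larger than `l`. -/
def pTail {n : ℕ} (H : Matrix (Fin n) (Fin n) ℝ) (k m l : ℕ) : ℝ :=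
  ∑ p ∈ (indexSet k m).filter (fun p => ∀ h : 0 < m, l < (p ⟨0, h⟩).2),
    ∏ r, entry H (p r).1 (p r).2

lemma colSum_eq_zero {n : ℕ} (H : Matrix (Fin n) (Fin n) ℝ) {k j : ℕ} (h : k ≤ j) :
    colSum H k j = 0 := by
  simp [colSum, Ico_eq_empty_of_le h]

lemma cons_mem_indexSet {k m : ℕ} {x : ℕ × ℕ} {p : Fin m → ℕ × ℕ} :
    (Fin.cons x p : Fin (m + 1) → ℕ × ℕ) ∈ indexSet k (m + 1) ↔
      (1 ≤ x.2 ∧ x.2 ≤ x.1 ∧ x.1 ≤ k) ∧ p ∈ indexSet k m ∧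
        ∀ h : 0 < m, x.1 < (p ⟨0, h⟩).2 := by
  simp only [indexSet, mem_filter, Fintype.mem_piFinset, mem_product, mem_Icc, Fin.forall_fin_succ,
    Fin.cons_zero, Fin.cons_succ, Fin.val_zero, Fin.val_succ]
  constructor
  · rintro ⟨⟨hx, hp⟩, ⟨hx', hp'⟩, ⟨-, hs⟩, ht⟩
    refine ⟨⟨hx.2.1, hx', hx.1.2⟩, ⟨hp, hp', fun r s hrs => ?_⟩, fun h => ?_⟩
    · exact (ht r).2 s (by omega)
    · exact hs ⟨0, h⟩ rfl
  · rintro ⟨⟨h1, h2, h3⟩, ⟨hp, hp', ht⟩, h0⟩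
    refine ⟨⟨⟨⟨by omega, h3⟩, ⟨h1, by omega⟩⟩, hp⟩, ⟨h2, hp'⟩, ⟨by omega, fun i hi => ?_⟩,
      fun i => ⟨by omega, fun s hs => ht i s (by omega)⟩⟩
    have : i = ⟨0, i.pos⟩ := Fin.ext (by simpa using hi)
    rw [this]
    exact h0 _

lemma Q_succ {n : ℕ} (H : Matrix (Fin n) (Fin n) ℝ) (k m : ℕ) {j : ℕ} (hj : 1 ≤ j) :
    Q H k (m + 1) j = ∑ i ∈ Icc j k, entry H i j * pTail H k m i := by
  simp only [pTail, mul_sum]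
  rw [sum_sigma', Q]
  refine sum_nbij' (fun p => ⟨(p 0).1, Fin.tail p⟩)
    (fun x => (Fin.cons (x.1, j) x.2 : Fin (m + 1) → ℕ × ℕ)) ?_ ?_ ?_ ?_ ?_
  · intro p hp
    obtain ⟨hp, _, hpj⟩ := mem_filter.1 hp
    rw [← Fin.cons_self_tail p, cons_mem_indexSet] at hp
    simp only [mem_sigma, mem_Icc, mem_filter]
    exact ⟨⟨hpj ▸ hp.1.2.1, hp.1.2.2⟩, hp.2⟩
  · rintro ⟨i, p⟩ hx
    simp only [mem_sigma, mem_Icc, mem_filter] at hx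
    exact mem_filter.2 ⟨cons_mem_indexSet.2 ⟨⟨hj, hx.1.1, hx.1.2⟩, hx.2⟩, Nat.succ_pos m, rfl⟩
  · intro p hp
    obtain ⟨-, _, rfl⟩ := mem_filter.1 hp
    exact Fin.cons_self_tail p
  · rintro ⟨i, p⟩ -
    simp
  · intro p hp
    obtain ⟨-, _, rfl⟩ := mem_filter.1 hp
    rw [Fin.prod_univ_succ]
    rfl

lemma pTail_succ {n : ℕ} (H : Matrix (Fin n) (Fin n) ℝ) (k m l : ℕ) :
    pTail H k (m + 1) l = ∑ j ∈ Ioc l k, Q H k (m + 1) j := by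
  rw [pTail, ← sum_fiberwise_of_maps_to (g := fun p : Fin (m + 1) → ℕ × ℕ => (p 0).2)
    (t := Ioc l k)]
  · refine sum_congr rfl fun j hj => ?_
    rw [Q, filter_filter]
    refine sum_congr (filter_congr fun p _ => ?_) fun _ _ => rfl
    constructor
    · rintro ⟨-, h⟩
      exact ⟨Nat.succ_pos m, h⟩
    · rintro ⟨_, h⟩
      exact ⟨fun _ => (mem_Ioc.1 hj).1.trans_eq h.symm, h⟩
  · intro p hp
    simp only [indexSet, mem_filter, Fintype.mem_piFinset, mem_product, mem_Icc] at hp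
    exact mem_Ioc.2 ⟨hp.2 (Nat.succ_pos m), (hp.1.1 0).2.2⟩

lemma P_eq_pTail {n : ℕ} (H : Matrix (Fin n) (Fin n) ℝ) (k m : ℕ) : P H k m = pTail H k m 0 := by
  rw [P, pTail, filter_true_of_mem]
  intro p hp h
  simp only [indexSet, mem_filter, Fintype.mem_piFinset, mem_product, mem_Icc] at hp
  exact (hp.1 ⟨0, h⟩).2.1

lemma pTail_zero {n : ℕ} (H : Matrix (Fin n) (Fin n) ℝ) (k l : ℕ) : pTail H k 0 l = 1 := by
  have : indexSet k 0 = univ := by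
    ext p
    simp [indexSet]
  simp [pTail, this]

section

variable {N : ℕ} (H : Matrix (Fin (N - 1)) (Fin (N - 1)) ℝ)

lemma qVec_eq_zero {n : ℕ} (N : ℕ) (H : Matrix (Fin n) (Fin n) ℝ) {a k : ℕ} (h : N < a + k) :
    qVec N H a k = 0 := by
  induction a generalizing k with
  | zero => rw [qVec, if_neg (by omega)]
  | succ a ih =>
    rw [qVec]
    refine sum_eq_zero fun i _ => ?_
    rcases le_or_gt i k with hik | hik
    · rw [colSum_eq_zero H hik, mul_zero]
    · rw [ih (by omega), zero_mul]

lemma qVec_and_pTail (m : ℕ) :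
    (∀ j, 1 ≤ j → qVec N H (m + 1) j = Q H (N - 1) (m + 1) j) ∧
      ∀ l, l < N → pTail H (N - 1) m l = ∑ j ∈ Ioc l N, qVec N H m j := by
  have step (m : ℕ) (h : ∀ l, l < N → pTail H (N - 1) m l = ∑ j ∈ Ioc l N, qVec N H m j) :
      ∀ j, 1 ≤ j → qVec N H (m + 1) j = Q H (N - 1) (m + 1) j := by
    intro j hj
    rw [Q_succ H _ _ hj, qVec]
    have h1 : ∑ i ∈ Icc j (N - 1), entry H i j * pTail H (N - 1) m i
        = ∑ i ∈ Icc j (N - 1), ∑ k ∈ Ioc i N, qVec N H m k * entry H i j := by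
      refine sum_congr rfl fun i hi => ?_
      have := mem_Icc.1 hi
      rw [h i (by omega), mul_comm, sum_mul]
    simp only [h1, colSum, mul_sum]
    refine sum_comm' fun k i => ?_
    simp only [mem_Icc, mem_Ico, mem_Ioc]
    omega
  have hp : ∀ l, l < N → pTail H (N - 1) m l = ∑ j ∈ Ioc l N, qVec N H m j := by
    induction m with
    | zero =>
      intro l hl
      rw [pTail_zero]
      simp only [qVec]
      rw [sum_ite_eq' (Ioc l N) N, if_pos (mem_Ioc.2 ⟨hl, le_rfl⟩)]
    | succ m ih =>
      intro l hl
      have h0 : qVec N H (m + 1) N = 0 := qVec_eq_zero N H (by omega)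
      obtain ⟨M, rfl⟩ : ∃ M, N = M + 1 := ⟨N - 1, by omega⟩
      rw [pTail_succ, show Ioc l (M + 1) = insert (M + 1) (Ioc l M) from
        (insert_Ioc_right_eq_Ioc_succ (Nat.le_of_lt_succ hl)).symm, sum_insert (by simp), h0, zero_add]
      refine sum_congr rfl fun j hj => ?_
      exact (step m ih j (by have := mem_Ioc.1 hj; omega)).symm
  exact ⟨step m hp, hp⟩

lemma qVec_succ_eq_Q (m : ℕ) {j : ℕ} (hj : 1 ≤ j) :
    qVec N H (m + 1) j = Q H (N - 1) (m + 1) j :=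
  (qVec_and_pTail H m).1 j hj

lemma P_eq_sum_qVec (hN : 1 ≤ N) (m : ℕ) : P H (N - 1) m = ∑ j ∈ Icc 1 N, qVec N H m j := by
  rw [P_eq_pTail, (qVec_and_pTail H m).2 0 hN]
  rfl

lemma qVec_diagonal {j : ℕ} (hj : 1 ≤ j) (hjN : j < N) :
    qVec N H (N - j) j = qVec N H (N - (j + 1)) (j + 1) * entry H j j := by
  rw [show N - j = N - (j + 1) + 1 by omega, qVec, sum_eq_single_of_mem (j + 1)]
  · simp [colSum]
  · exact mem_Icc.2 ⟨by omega, by omega⟩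
  · intro k hk hkj
    rcases lt_or_gt_of_ne hkj with h | h
    · rw [colSum_eq_zero H (by omega), mul_zero]
    · rw [qVec_eq_zero N H (by omega), zero_mul]

/-- The entries on the border of the support of the Q-functions are the partial products of the
diagonal of `H`, all of which divide `P(N-1, N-1; H) = 1/N`. -/
lemma qVec_diagonal_ne_zero (hH : HInvariance N H) (hN : 2 ≤ N) {k : ℕ} (hk : 1 ≤ k)
    (hkN : k ≤ N) : qVec N H (N - k) k ≠ 0 := by
  induction k, hk using Nat.le_induction with
  | base =>
    have h := hH (N - 1) (by omega) le_rfl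
    rw [P_eq_sum_qVec H (by omega), sum_eq_single_of_mem 1 (mem_Icc.2 ⟨le_rfl, hkN⟩)] at h
    · rw [h, show N - 1 + 1 = N by omega, Nat.choose_self]
      have : (N : ℝ) ≠ 0 := by positivity
      simpa using this
    · intro k hk hk1
      have := mem_Icc.1 hk
      exact qVec_eq_zero N H (by omega)
  | succ k hk ih =>
    have h := ih (by omega)
    rw [qVec_diagonal H hk (by omega)] at h
    exact left_ne_zero_of_mul h

end

/-! ### The certificate matrix -/

/-- Under H-invariance, the Laplacian matrix of the H-certificates with `1` added to its last
diagonal entry. It solves a Lyapunov equation for every `H`, see `sum_certMatrix_mul`. -/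
def certMatrix {n : ℕ} (N : ℕ) (H : Matrix (Fin n) (Fin n) ℝ) (i j : ℕ) : ℝ :=
  N * ∑ a ∈ range N, ∑ b ∈ range N,
    (-1) ^ (a + b) * ((a + b).choose a : ℝ) * (qVec N H a i * qVec N H b j)

/-- The H-certificates in closed form, as a quadratic expression in the Q-functions. -/
def certFormula {n : ℕ} (N : ℕ) (H : Matrix (Fin n) (Fin n) ℝ) (k j : ℕ) : ℝ :=
  if 1 ≤ j ∧ j < k ∧ k ≤ N then -certMatrix N H k j else 0

lemma certMatrix_comm {n : ℕ} (N : ℕ) (H : Matrix (Fin n) (Fin n) ℝ) (i j : ℕ) :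
    certMatrix N H i j = certMatrix N H j i := by
  unfold certMatrix
  rw [sum_comm]
  congr 1
  refine sum_congr rfl fun a _ => sum_congr rfl fun b _ => ?_
  rw [add_comm b a, Nat.choose_symm_add]
  ring

/-- The row sums of the certificate matrix. This is the only place where H-invariance enters the
existence of the certificates. -/
lemma sum_certMatrix {N : ℕ} {H : Matrix (Fin (N - 1)) (Fin (N - 1)) ℝ} (hN : 1 ≤ N)
    (hH : HInvariance N H) (i : ℕ) :
    ∑ j ∈ Icc 1 N, certMatrix N H i j = if i = N then 1 else 0 := by
  have hN0 : (N : ℝ) ≠ 0 := by positivity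
  have hP : ∀ b ∈ range N, ∑ j ∈ Icc 1 N, qVec N H b j = 1 / (N : ℝ) * (N.choose (b + 1) : ℝ) := by
    intro b hb
    rcases Nat.eq_zero_or_pos b with rfl | hb0
    · simp only [qVec]
      rw [sum_ite_eq' (Icc 1 N) N, if_pos (mem_Icc.2 ⟨hN, le_rfl⟩)]
      simp [hN0]
    · rw [← P_eq_sum_qVec H hN, hH b hb0 (by have := mem_range.1 hb; omega)]
  simp only [certMatrix]
  rw [← mul_sum, sum_comm]
  have h (a : ℕ) (ha : a ∈ range N) :
      ∑ j ∈ Icc 1 N, ∑ b ∈ range N,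
        (-1) ^ (a + b) * ((a + b).choose a : ℝ) * (qVec N H a i * qVec N H b j)
      = 1 / N * (qVec N H a i * if a = 0 then 1 else 0) := by
    rw [← alternating_sum_choose_mul_choose_succ (mem_range.1 ha), sum_comm, mul_sum, mul_sum]
    refine sum_congr rfl fun b hb => ?_
    rw [← mul_sum, ← mul_sum, hP b hb]
    ring
  rw [sum_congr rfl h, ← mul_sum]
  simp only [mul_ite, mul_one, mul_zero]
  rw [sum_ite_eq' (range N) 0, if_pos (mem_range.2 hN), qVec]
  field_simp

/-- Telescoping by Pascal's rule: the coefficients `(-1)^(a+b) binom(a+b, a)` solve the Lyapunov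
equation for a nilpotent shift. -/
lemma sum_choose_shift {N : ℕ} {B : ℕ → ℕ → ℝ} (hB : ∀ a b, B a b = B b a)
    (h0 : ∀ b, B N b = 0) :
    ∑ a ∈ range N, ∑ b ∈ range N, (-1) ^ (a + b) * ((a + b).choose a : ℝ) *
      (B a b + 2 * B (a + 1) b) = B 0 0 := by
  set c : ℕ → ℕ → ℝ := fun a b => (-1) ^ (a + b) * ((a + b).choose a : ℝ) with hc
  have hc_comm (a b) : c a b = c b a := by
    simp only [hc]
    rw [add_comm, Nat.choose_symm_add]
  have hc0 (a) : c (a + 1) 0 = -c a 0 := by simp [hc, pow_succ]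
  have hcs (a b) : c (a + 1) (b + 1) = -c a (b + 1) - c (a + 1) b := by
    simp only [hc]
    rw [show a + 1 + (b + 1) = (a + b + 1) + 1 by ring, Nat.choose_succ_succ,
      show a + (b + 1) = a + b + 1 by ring, show a + 1 + b = a + b + 1 by ring]
    push_cast
    ring
  have shift (f : ℕ → ℝ) (h : f N = 0) :
      ∑ a ∈ range N, f a = f 0 + ∑ a ∈ range N, f (a + 1) := by
    rw [add_comm, ← sum_range_succ', sum_range_succ, h, add_zero]
  have h0' (a) : B a N = 0 := by rw [hB, h0]
  have hX : ∑ a ∈ range N, ∑ b ∈ range N, c a b * B a b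
      = B 0 0 - ∑ a ∈ range N, c a 0 * B (a + 1) 0 - ∑ a ∈ range N, c a 0 * B (a + 1) 0
        + ∑ a ∈ range N, ∑ b ∈ range N, c (a + 1) (b + 1) * B (a + 1) (b + 1) := by
    rw [shift _ (by simp [h0]), shift _ (by simp [h0'])]
    have h1 (a : ℕ) : ∑ b ∈ range N, c (a + 1) b * B (a + 1) b
        = -(c a 0 * B (a + 1) 0) + ∑ b ∈ range N, c (a + 1) (b + 1) * B (a + 1) (b + 1) := by
      rw [shift _ (by simp [h0']), hc0]
      ring
    have h2 : ∑ b ∈ range N, c 0 (b + 1) * B 0 (b + 1)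
        = -∑ a ∈ range N, c a 0 * B (a + 1) 0 := by
      rw [← sum_neg_distrib]
      refine sum_congr rfl fun b _ => ?_
      rw [hc_comm, hc0, hB]
      ring
    simp only [h1, sum_add_distrib, h2, sum_neg_distrib]
    simp [hc]
    ring
  have hY : ∑ a ∈ range N, ∑ b ∈ range N, c a b * B (a + 1) b
      = ∑ a ∈ range N, c a 0 * B (a + 1) 0
        + ∑ a ∈ range N, ∑ b ∈ range N, c a (b + 1) * B (a + 1) (b + 1) := by
    rw [← sum_add_distrib]
    exact sum_congr rfl fun a _ => shift _ (by simp [h0'])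
  have hZ : ∑ a ∈ range N, ∑ b ∈ range N, c a (b + 1) * B (a + 1) (b + 1)
      = ∑ a ∈ range N, ∑ b ∈ range N, c (a + 1) b * B (a + 1) (b + 1) := by
    rw [sum_comm]
    refine sum_congr rfl fun a _ => sum_congr rfl fun b _ => ?_
    rw [hc_comm, hB]
  have hW : ∑ a ∈ range N, ∑ b ∈ range N, c (a + 1) (b + 1) * B (a + 1) (b + 1)
      = -∑ a ∈ range N, ∑ b ∈ range N, c a (b + 1) * B (a + 1) (b + 1)
        - ∑ a ∈ range N, ∑ b ∈ range N, c (a + 1) b * B (a + 1) (b + 1) := by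
    simp only [hcs, sub_mul, neg_mul, sum_sub_distrib, sum_neg_distrib]
  have hS : ∑ a ∈ range N, ∑ b ∈ range N, c a b * (B a b + 2 * B (a + 1) b)
      = ∑ a ∈ range N, ∑ b ∈ range N, c a b * B a b
        + 2 * ∑ a ∈ range N, ∑ b ∈ range N, c a b * B (a + 1) b := by
    simp only [mul_add, sum_add_distrib, mul_sum]
    congr 1
    exact sum_congr rfl fun a _ => sum_congr rfl fun b _ => by ring
  rw [hS, hX, hY, hW, ← hZ]
  ring

lemma sum_sum_sum_sum_comm (s t : Finset ℕ) (F : ℕ → ℕ → ℕ → ℕ → ℝ) :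
    ∑ k ∈ s, ∑ j ∈ s, ∑ a ∈ t, ∑ b ∈ t, F k j a b
      = ∑ a ∈ t, ∑ b ∈ t, ∑ k ∈ s, ∑ j ∈ s, F k j a b := by
  calc _ = ∑ k ∈ s, ∑ a ∈ t, ∑ j ∈ s, ∑ b ∈ t, F k j a b := sum_congr rfl fun _ _ => sum_comm
    _ = ∑ a ∈ t, ∑ k ∈ s, ∑ b ∈ t, ∑ j ∈ s, F k j a b := by
      rw [sum_comm]
      exact sum_congr rfl fun _ _ => sum_congr rfl fun _ _ => sum_comm
    _ = _ := sum_congr rfl fun _ _ => sum_comm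

/-- The Lyapunov equation of the certificate matrix, tested against a symmetric matrix `G`. -/
lemma sum_certMatrix_mul {n : ℕ} {N : ℕ} (H : Matrix (Fin n) (Fin n) ℝ) (hN : 1 ≤ N)
    {G : ℕ → ℕ → ℝ} (hG : ∀ i j, G i j = G j i) :
    ∑ k ∈ Icc 1 N, ∑ j ∈ Icc 1 N, certMatrix N H k j *
      (G k j + 2 * ∑ i ∈ Icc 1 N, colSum H k i * G i j) = N * G N N := by
  set B : ℕ → ℕ → ℝ := fun a b =>
    ∑ k ∈ Icc 1 N, ∑ j ∈ Icc 1 N, qVec N H a k * qVec N H b j * G k j with hB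
  have hB_comm (a b) : B a b = B b a := by
    simp only [hB]
    rw [sum_comm]
    refine sum_congr rfl fun k _ => sum_congr rfl fun j _ => ?_
    rw [hG]
    ring
  have hBN (b) : B N b = 0 := by
    refine sum_eq_zero fun k hk => sum_eq_zero fun j _ => ?_
    rw [qVec_eq_zero N H (by have := mem_Icc.1 hk; omega)]
    ring
  have hB0 : B 0 0 = G N N := by
    simp only [hB, qVec, ite_mul, one_mul, zero_mul]
    have hmem : N ∈ Icc 1 N := mem_Icc.2 ⟨hN, le_rfl⟩
    rw [sum_eq_single_of_mem N hmem, sum_eq_single_of_mem N hmem]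
    · simp
    · intro j _ hj
      simp [hj]
    · intro j _ hj
      simp [hj]
  have hBs (a b) : B (a + 1) b = ∑ k ∈ Icc 1 N, ∑ j ∈ Icc 1 N, qVec N H a k * qVec N H b j *
      ∑ i ∈ Icc 1 N, colSum H k i * G i j := by
    simp only [hB, qVec, sum_mul, mul_sum]
    calc _ = ∑ i ∈ Icc 1 N, ∑ k ∈ Icc 1 N, ∑ j ∈ Icc 1 N,
          qVec N H a k * colSum H k i * qVec N H b j * G i j :=
        sum_congr rfl fun i _ => sum_comm
      _ = ∑ k ∈ Icc 1 N, ∑ i ∈ Icc 1 N, ∑ j ∈ Icc 1 N,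
          qVec N H a k * colSum H k i * qVec N H b j * G i j := sum_comm
      _ = _ := by
        refine sum_congr rfl fun k _ => ?_
        rw [sum_comm]
        exact sum_congr rfl fun j _ => sum_congr rfl fun i _ => by ring
  set W : ℕ → ℕ → ℝ := fun k j => G k j + 2 * ∑ i ∈ Icc 1 N, colSum H k i * G i j with hW
  have hBW (a b) : B a b + 2 * B (a + 1) b
      = ∑ k ∈ Icc 1 N, ∑ j ∈ Icc 1 N, qVec N H a k * qVec N H b j * W k j := by
    rw [hBs, mul_sum, ← sum_add_distrib]
    refine sum_congr rfl fun k _ => ?_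
    rw [mul_sum, ← sum_add_distrib]
    exact sum_congr rfl fun j _ => by simp only [hW]; ring
  change ∑ k ∈ Icc 1 N, ∑ j ∈ Icc 1 N, certMatrix N H k j * W k j = _
  rw [← hB0, ← sum_choose_shift hB_comm hBN]
  simp only [hBW, certMatrix, mul_sum, sum_mul]
  rw [sum_sum_sum_sum_comm]
  exact sum_congr rfl fun _ _ => sum_congr rfl fun _ _ => sum_congr rfl fun _ _ =>
    sum_congr rfl fun _ _ => by ring

/-! ### Existence and uniqueness of the H-certificates -/

section

variable {V : Type*} [NormedAddCommGroup V] [InnerProductSpace ℝ V]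

lemma yVec_eq {N : ℕ} (H : Matrix (Fin (N - 1)) (Fin (N - 1)) ℝ) (y₀ : V) (g : ℕ → V) {k : ℕ}
    (hk : k + 1 ≤ N) :
    yVec H y₀ g k = y₀ - ∑ i ∈ Icc 1 N, (2 * colSum H (k + 1) i) • g i := by
  induction k with
  | zero =>
    rw [sum_eq_zero, sub_zero, yVec]
    intro i hi
    rw [colSum_eq_zero H (mem_Icc.1 hi).1]
    simp
  | succ k ih =>
    rw [yVec, ih (by omega), sub_sub, ← sub_eq_zero, sub_sub_sub_cancel_left, sub_eq_zero]
    have h : ∑ j ∈ Icc 1 (k + 1), (2 * entry H (k + 1) j) • g j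
        = ∑ j ∈ Icc 1 N, (2 * (colSum H (k + 1 + 1) j - colSum H (k + 1) j)) • g j := by
      refine sum_congr_of_eq_on_inter ?_ ?_ ?_
      · intro j hj hj'
        simp only [mem_Icc] at hj hj'
        omega
      · intro j hj hj'
        simp only [mem_Icc] at hj hj'
        rw [colSum_eq_zero H (by omega), colSum_eq_zero H (by omega)]
        simp
      · intro j hj _
        rw [colSum, colSum, sum_Ico_succ_top (mem_Icc.1 hj).2]
        ring_nf
    rw [h, ← sum_add_distrib]
    refine sum_congr rfl fun j _ => ?_
    rw [← add_smul]
    ring_nf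

lemma inner_xVec_sub {N : ℕ} (H : Matrix (Fin (N - 1)) (Fin (N - 1)) ℝ) (y₀ : V) (g : ℕ → V) {k : ℕ}
    (hk : 1 ≤ k) (hkN : k ≤ N) (v : V) :
    inner ℝ (xVec H y₀ g k - y₀) v
      = -(inner ℝ (g k) v + 2 * ∑ i ∈ Icc 1 N, colSum H k i * inner ℝ (g i) v) := by
  rw [xVec, yVec_eq H y₀ g (by omega), Nat.sub_add_cancel hk, sub_right_comm, sub_sub_cancel_left,
    inner_sub_left, inner_neg_left, sum_inner, mul_sum, neg_add_rev, sub_eq_add_neg]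
  congr 2
  exact sum_congr rfl fun i _ => by rw [real_inner_smul_left]; ring

/-- The quadratic form of a symmetric matrix with zero row sums, written through differences. -/
lemma sum_laplacian {N : ℕ} {S : ℕ → ℕ → ℝ} (hS : ∀ i j, S i j = S j i)
    (h0 : ∀ i ∈ Icc 1 N, ∑ j ∈ Icc 1 N, S i j = 0) (y₀ : V) (x g : ℕ → V) :
    ∑ k ∈ Icc 1 N, ∑ j ∈ Ico 1 k, -S k j * inner ℝ (x k - x j) (g k - g j)
      = ∑ k ∈ Icc 1 N, ∑ j ∈ Icc 1 N, S k j * inner ℝ (x k - y₀) (g j) := by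
  set f : ℕ → ℕ → ℝ := fun k j => -S k j * inner ℝ (x k - x j) (g k - g j) with hf
  have hfc (k j) : f k j = f j k := by
    simp only [hf]
    rw [hS, ← neg_sub (x j), ← neg_sub (g j), inner_neg_neg]
  have hfd (k) : f k k = 0 := by simp [hf]
  have h1 : ∑ k ∈ Icc 1 N, ∑ j ∈ Icc 1 N, f k j
      = 2 * ∑ k ∈ Icc 1 N, ∑ j ∈ Ico 1 k, f k j := by
    have hs : ∀ k ∈ Icc 1 N, ∑ j ∈ Icc 1 N, f k j
        = ∑ j ∈ Ico 1 k, f k j + ∑ j ∈ Ioc k N, f k j := by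
      intro k hk
      have hk' := mem_Icc.1 hk
      have : Icc 1 N = insert k (Ico 1 k ∪ Ioc k N) := by
        ext j
        simp only [mem_insert, mem_union, mem_Icc, mem_Ico, mem_Ioc]
        omega
      rw [this, sum_insert (by simp), hfd, zero_add, sum_union]
      rw [disjoint_left]
      intro j hj hj'
      simp only [mem_Ico, mem_Ioc] at hj hj'
      omega
    rw [sum_congr rfl hs, sum_add_distrib, two_mul]
    congr 1
    rw [sum_comm' (t' := Icc 1 N) (s' := fun j => Ico 1 j)]
    · exact sum_congr rfl fun k _ => sum_congr rfl fun j _ => hfc j k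
    · intro k j
      simp only [mem_Icc, mem_Ico, mem_Ioc]
      omega
  have h2 : ∑ k ∈ Icc 1 N, ∑ j ∈ Icc 1 N, f k j
      = 2 * ∑ k ∈ Icc 1 N, ∑ j ∈ Icc 1 N, S k j * inner ℝ (x k - y₀) (g j) := by
    have e (k j) : f k j = S k j * inner ℝ (x k - y₀) (g j) + S j k * inner ℝ (x j - y₀) (g k)
        - (S k j * inner ℝ (x k - y₀) (g k) + S j k * inner ℝ (x j - y₀) (g j)) := by
      simp only [hf]
      rw [hS j k, show x k - x j = (x k - y₀) - (x j - y₀) by abel, inner_sub_left,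
        inner_sub_right, inner_sub_right]
      ring
    have z : ∑ k ∈ Icc 1 N, ∑ j ∈ Icc 1 N, S k j * inner ℝ (x k - y₀) (g k) = 0 :=
      sum_eq_zero fun k hk => by rw [← sum_mul, h0 k hk, zero_mul]
    simp only [e, sum_add_distrib, sum_sub_distrib]
    rw [sum_comm (f := fun k j => S j k * inner ℝ (x j - y₀) (g k)),
      sum_comm (f := fun k j => S j k * inner ℝ (x j - y₀) (g j)), z]
    ring
  linarith

/-- The sum in the defining equation of the H-certificates as a quadratic form in `g_1, …, g_N`, for
the symmetric matrix `S` with zero row sums whose off-diagonal entries are the negative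
certificates. -/
lemma sum_certificate_terms {N : ℕ} (H : Matrix (Fin (N - 1)) (Fin (N - 1)) ℝ) {S : ℕ → ℕ → ℝ}
    (hS : ∀ i j, S i j = S j i) (h0 : ∀ i ∈ Icc 1 N, ∑ j ∈ Icc 1 N, S i j = 0)
    (y₀ : V) (g : ℕ → V) :
    ∑ k ∈ Icc 1 N, ∑ j ∈ Ico 1 k, -S k j * inner ℝ (xVec H y₀ g k - xVec H y₀ g j) (g k - g j)
      = -∑ k ∈ Icc 1 N, ∑ j ∈ Icc 1 N, S k j *
          (inner ℝ (g k) (g j) + 2 * ∑ i ∈ Icc 1 N, colSum H k i * inner ℝ (g i) (g j)) := by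
  rw [sum_laplacian hS h0 y₀, ← sum_neg_distrib]
  refine sum_congr rfl fun k hk => ?_
  rw [← sum_neg_distrib]
  refine sum_congr rfl fun j _ => ?_
  rw [inner_xVec_sub H y₀ g (mem_Icc.1 hk).1 (mem_Icc.1 hk).2]
  ring

end

/-- The closed formula solves the defining equation: the zero row sums turn the equation into the
Lyapunov equation of the certificate matrix. -/
lemma isCertificate_certFormula {N : ℕ} {H : Matrix (Fin (N - 1)) (Fin (N - 1)) ℝ} (hN : 1 ≤ N)
    (hH : HInvariance N H) : IsCertificate N H (certFormula N H) := by
  refine ⟨fun k j h => if_neg h, fun d y₀ g => ?_⟩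
  set S : ℕ → ℕ → ℝ := fun i j => certMatrix N H i j - if i = N ∧ j = N then 1 else 0 with hS
  have hSc (i j) : S i j = S j i := by simp only [hS, certMatrix_comm N H i j, and_comm]
  have hmem : N ∈ Icc 1 N := mem_Icc.2 ⟨hN, le_rfl⟩
  have hdelta (i : ℕ) : ∑ j ∈ Icc 1 N, (if i = N ∧ j = N then (1 : ℝ) else 0)
      = if i = N then 1 else 0 := by
    rw [sum_eq_single_of_mem N hmem (fun j _ hj => if_neg fun h => hj h.2)]
    simp
  have hS0 : ∀ i ∈ Icc 1 N, ∑ j ∈ Icc 1 N, S i j = 0 := by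
    intro i _
    simp only [hS]
    rw [sum_sub_distrib, sum_certMatrix hN hH, hdelta, sub_self]
  have h1 : ∑ k ∈ Icc 1 N, ∑ j ∈ Ico 1 k,
        certFormula N H k j * inner ℝ (xVec H y₀ g k - xVec H y₀ g j) (g k - g j)
      = ∑ k ∈ Icc 1 N, ∑ j ∈ Ico 1 k,
        -S k j * inner ℝ (xVec H y₀ g k - xVec H y₀ g j) (g k - g j) := by
    refine sum_congr rfl fun k hk => sum_congr rfl fun j hj => ?_
    have hk := mem_Icc.1 hk
    have hj := mem_Ico.1 hj
    rw [certFormula, if_pos ⟨hj.1, hj.2, hk.2⟩]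
    simp only [hS]
    rw [if_neg (by omega), sub_zero]
  have h2 := sum_certMatrix_mul H hN (G := fun i j => inner ℝ (g i) (g j))
    fun i j => real_inner_comm _ _
  have h3 : ∑ k ∈ Icc 1 N, ∑ j ∈ Icc 1 N, (if k = N ∧ j = N then (1 : ℝ) else 0) *
      (inner ℝ (g k) (g j) + 2 * ∑ i ∈ Icc 1 N, colSum H k i * inner ℝ (g i) (g j))
      = inner ℝ (g N) (g N) + 2 * ∑ i ∈ Icc 1 N, colSum H N i * inner ℝ (g i) (g N) := by
    rw [sum_eq_single_of_mem N hmem, sum_eq_single_of_mem N hmem]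
    · simp
    · intro j _ hj
      rw [if_neg fun h => hj h.2, zero_mul]
    · intro k _ hk
      exact sum_eq_zero fun j _ => by rw [if_neg fun h => hk h.1, zero_mul]
  rw [h1, sum_certificate_terms H hSc hS0]
  simp only [hS, sub_mul, sum_sub_distrib]
  rw [h2, h3, real_inner_comm, inner_xVec_sub H y₀ g hN le_rfl, real_inner_self_eq_norm_sq]
  ring

lemma add_transpose_eq_zero_of_quadratic_form_eq_zero {s : Finset ℕ} {A : ℕ → ℕ → ℝ}
    (h : ∀ g : ℕ → ℝ, ∑ i ∈ s, ∑ j ∈ s, A i j * (g i * g j) = 0) {i j : ℕ} (hi : i ∈ s)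
    (hj : j ∈ s) : A i j + A j i = 0 := by
  have h1 := h fun k => (if k = i then 1 else 0) + if k = j then 1 else 0
  have h2 := h fun k => if k = i then 1 else 0
  have h3 := h fun k => if k = j then 1 else 0
  simp only [mul_add, sum_add_distrib, mul_ite, mul_one, mul_zero, sum_ite_eq', hi, hj,
    if_true] at h1 h2 h3
  linarith

/-- A Lyapunov equation with a unitriangular matrix has no nonzero symmetric homogeneous solution. -/
lemma eq_zero_of_lyapunov {N : ℕ} {K S : ℕ → ℕ → ℝ} (hK : ∀ k j, k ≤ j → K k j = 0)
    (h : ∀ i ∈ Icc 1 N, ∀ j ∈ Icc 1 N,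
      (S i j + 2 * ∑ k ∈ Icc 1 N, S k j * K k i) + (S j i + 2 * ∑ k ∈ Icc 1 N, S k i * K k j) = 0)
    (hS : ∀ i j, S i j = S j i) : ∀ i ∈ Icc 1 N, ∀ j ∈ Icc 1 N, S i j = 0 := by
  have main (m : ℕ) : ∀ i ∈ Icc 1 N, ∀ j ∈ Icc 1 N, 2 * N - i - j = m → S i j = 0 := by
    induction m using Nat.strong_induction_on with
    | _ m ih =>
      intro i hi j hj hm
      have hi' := mem_Icc.1 hi
      have hj' := mem_Icc.1 hj
      have hz (i j : ℕ) (hi : i ∈ Icc 1 N) (hj : j ∈ Icc 1 N) (hm : 2 * N - i - j = m) :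
          ∑ k ∈ Icc 1 N, S k j * K k i = 0 := by
        refine sum_eq_zero fun k hk => ?_
        have hi' := mem_Icc.1 hi
        have hj' := mem_Icc.1 hj
        have hk' := mem_Icc.1 hk
        rcases le_or_gt k i with hki | hki
        · rw [hK k i hki, mul_zero]
        · rw [ih _ (by omega) k hk j hj rfl, zero_mul]
      have := h i hi j hj
      rw [hz i j hi hj hm, hz j i hj hi (by omega), hS j i] at this
      linarith
  exact fun i hi j hj => main _ i hi j hj rfl

/-- The difference of two solutions has a Laplacian that solves a homogeneous Lyapunov equation. -/
lemma IsCertificate.unique {N : ℕ} {H : Matrix (Fin (N - 1)) (Fin (N - 1)) ℝ} {lam lam' : ℕ → ℕ → ℝ}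
    (h : IsCertificate N H lam) (h' : IsCertificate N H lam') : lam = lam' := by
  set del : ℕ → ℕ → ℝ := fun k j => lam k j - lam' k j with hdel
  have hdel0 (k j) (hkj : ¬ (1 ≤ j ∧ j < k ∧ k ≤ N)) : del k j = 0 := by
    simp only [hdel]
    rw [h.1 k j hkj, h'.1 k j hkj, sub_self]
  set S : ℕ → ℕ → ℝ := fun k j => -(del k j + del j k)
    + if k = j then ∑ i ∈ Icc 1 N, (del k i + del i k) else 0 with hS
  have hSc (i j) : S i j = S j i := by
    simp only [hS]
    by_cases hij : i = j
    · rw [hij]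
    · rw [if_neg hij, if_neg (Ne.symm hij), add_comm (del i j)]
  have hS0 : ∀ i ∈ Icc 1 N, ∑ j ∈ Icc 1 N, S i j = 0 := by
    intro i hi
    simp only [hS]
    rw [sum_add_distrib, sum_neg_distrib, sum_ite_eq, if_pos hi, neg_add_cancel]
  have hSdel (k j) (hjk : j < k) : -S k j = del k j := by
    simp only [hS]
    rw [if_neg hjk.ne', hdel0 j k (by omega)]
    ring
  have hz : ∀ i ∈ Icc 1 N, ∀ j ∈ Icc 1 N, S i j = 0 := by
    refine eq_zero_of_lyapunov (K := colSum H) (fun k j => colSum_eq_zero H) ?_ hSc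
    intro i hi j hj
    refine add_transpose_eq_zero_of_quadratic_form_eq_zero
      (A := fun i j => S i j + 2 * ∑ k ∈ Icc 1 N, S k j * colSum H k i) ?_ hi hj
    intro r
    -- the vectors `g_i` are taken in a space of dimension one
    set g : ℕ → EuclideanSpace ℝ (Fin 1) := fun i => r i • EuclideanSpace.single 0 1 with hg
    have hgi (i j) : inner ℝ (g i) (g j) = r i * r j := by
      simp [hg, real_inner_smul_left, real_inner_smul_right, mul_comm]
    have e := h.2 1 0 g
    have e' := h'.2 1 0 g
    have ed : ∑ k ∈ Icc 1 N, ∑ j ∈ Ico 1 k,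
        -S k j * inner ℝ (xVec H 0 g k - xVec H 0 g j) (g k - g j) = 0 := by
      have : ∑ k ∈ Icc 1 N, ∑ j ∈ Ico 1 k,
          -S k j * inner ℝ (xVec H 0 g k - xVec H 0 g j) (g k - g j)
          = ∑ k ∈ Icc 1 N, ∑ j ∈ Ico 1 k,
              lam k j * inner ℝ (xVec H 0 g k - xVec H 0 g j) (g k - g j)
            - ∑ k ∈ Icc 1 N, ∑ j ∈ Ico 1 k,
              lam' k j * inner ℝ (xVec H 0 g k - xVec H 0 g j) (g k - g j) := by
        rw [← sum_sub_distrib]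
        refine sum_congr rfl fun k _ => ?_
        rw [← sum_sub_distrib]
        refine sum_congr rfl fun j hj => ?_
        rw [hSdel k j (mem_Ico.1 hj).2, ← sub_mul]
      rw [this]
      linarith
    rw [sum_certificate_terms H hSc hS0, neg_eq_zero] at ed
    simp only [hgi] at ed
    rw [← ed]
    simp only [add_mul, mul_add, sum_add_distrib, mul_sum, sum_mul]
    congr 1
    calc _ = ∑ i ∈ Icc 1 N, ∑ k ∈ Icc 1 N, ∑ j ∈ Icc 1 N,
          2 * (S k j * colSum H k i) * (r i * r j) := sum_congr rfl fun _ _ => sum_comm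
      _ = ∑ k ∈ Icc 1 N, ∑ i ∈ Icc 1 N, ∑ j ∈ Icc 1 N,
          2 * (S k j * colSum H k i) * (r i * r j) := sum_comm
      _ = _ := by
        refine sum_congr rfl fun k _ => ?_
        rw [sum_comm]
        exact sum_congr rfl fun j _ => sum_congr rfl fun i _ => by ring
  funext k j
  by_cases hkj : 1 ≤ j ∧ j < k ∧ k ≤ N
  · have e := hSdel k j hkj.2.1
    rw [hz k (mem_Icc.2 ⟨by omega, hkj.2.2⟩) j (mem_Icc.2 ⟨hkj.1, by omega⟩), neg_zero] at e
    exact (sub_eq_zero.1 e.symm)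
  · rw [h.1 k j hkj, h'.1 k j hkj]

lemma certificate_eq_certFormula {N : ℕ} {H : Matrix (Fin (N - 1)) (Fin (N - 1)) ℝ} (hN : 1 ≤ N)
    (hH : HInvariance N H) : certificate N H = certFormula N H := by
  have h := isCertificate_certFormula hN hH
  have hex : ∃ lam, IsCertificate N H lam := ⟨_, h⟩
  rw [certificate, dif_pos hex]
  exact hex.choose_spec.unique h

/-! ### The profile as a family of scaled weights -/

/-- The dependence of the profile on `k`, up to a factor depending on `j` only. -/
noncomputable def profileWeight (N N' k j : ℕ) : ℝ :=
  if j < N' then 1 / ((k : ℝ) + 1) * ((N - j - 1).choose (k - 1) : ℝ)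
  else ((N - j - 1).choose (k - 1) : ℝ)

/-- The factor of the profile that depends on `j` only. -/
noncomputable def profileScale (N N' j : ℕ) : ℝ :=
  if j < N' then 1 else ((j : ℝ) - N' + 1) / ((N : ℝ) - N' + 1)

lemma profile_eq_scale_mul_weight (N N' k j : ℕ) :
    profile N N' k j = profileScale N N' j * profileWeight N N' k j := by
  unfold profile profileScale profileWeight
  split_ifs <;> ring

lemma profileWeight_eq_zero {N N' k j : ℕ} (h : N < k + j) (hj : j < N) :
    profileWeight N N' k j = 0 := by
  unfold profileWeight
  rw [Nat.choose_eq_zero_of_lt (by omega)]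
  simp

lemma profileWeight_pos {N N' j : ℕ} : 0 < profileWeight N N' (N - j) j := by
  unfold profileWeight
  rw [Nat.choose_self]
  split_ifs <;> positivity

lemma profileScale_pos {N N' j : ℕ} (h : N' ≤ N) : 0 < profileScale N N' j := by
  unfold profileScale
  split_ifs with hj
  · positivity
  · have h1 : (N' : ℝ) ≤ j := by exact_mod_cast not_lt.1 hj
    have h2 : (N' : ℝ) ≤ N := by exact_mod_cast h
    exact div_pos (by linarith) (by linarith)

lemma profile_eq_zero {N N' k j : ℕ} (h : N < k + j) (hj : j < N) : profile N N' k j = 0 := by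
  rw [profile_eq_scale_mul_weight, profileWeight_eq_zero h hj, mul_zero]

lemma profile_pos {N N' j : ℕ} (h : N' ≤ N) : 0 < profile N N' (N - j) j := by
  rw [profile_eq_scale_mul_weight]
  exact mul_pos (profileScale_pos h) profileWeight_pos

lemma sum_profileWeight_top_eq_zero {N N' j a : ℕ} (hj : N' ≤ j) (ha : a + 1 < N - j) :
    ∑ c ∈ range (N - j), (-1) ^ c * ((a + c + 1).choose a : ℝ) * profileWeight N N' (c + 1) j
      = 0 := by
  obtain ⟨n, hn⟩ : ∃ n, N - j = n + 1 := ⟨N - j - 1, by omega⟩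
  rw [hn, ← alternating_sum_choose_eq_zero (show a < n by omega) (a + 1)]
  refine sum_congr rfl fun c _ => ?_
  rw [profileWeight, if_neg (by omega), hn, Nat.add_sub_cancel, Nat.add_sub_cancel,
    show a + c + 1 = c + (a + 1) by ring]
  ring

lemma sum_profileWeight_top {N N' j n : ℕ} (hj : N' ≤ j) (hn : N - j = n + 1) :
    ∑ c ∈ range (N - j), (-1) ^ c * ((n + c + 1).choose n : ℝ) * profileWeight N N' (c + 1) j
      = (-1) ^ n := by
  have h := alternating_sum_choose n 0 (n + 1)
  rw [Nat.choose_zero_right, Nat.cast_one, mul_one, zero_add] at h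
  rw [hn, ← h]
  refine sum_congr rfl fun c _ => ?_
  rw [profileWeight, if_neg (by omega), hn, Nat.add_sub_cancel, Nat.add_sub_cancel,
    show n + c + 1 = c + (n + 1) by ring]
  ring

/-- Dividing `binom(a+c+1, a)` by `c + 2` gives a polynomial in `c` of degree `a - 1`, so that the
finite difference vanishes for one more value of `a` than in the undivided case. -/
lemma sum_profileWeight_bottom_eq_zero {N N' j a : ℕ} (hj : j < N') (ha : 1 ≤ a)
    (haN : a < N - j) :
    ∑ c ∈ range (N - j), (-1) ^ c * ((a + c + 1).choose a : ℝ) * profileWeight N N' (c + 1) j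
      = 0 := by
  obtain ⟨n, hn⟩ : ∃ n, N - j = n + 1 := ⟨N - j - 1, by omega⟩
  obtain ⟨a, rfl⟩ : ∃ a', a = a' + 1 := ⟨a - 1, by omega⟩
  rw [hn, ← mul_zero (1 / ((a : ℝ) + 1)),
    ← alternating_sum_choose_eq_zero (show a < n by omega) (a + 2), mul_sum]
  refine sum_congr rfl fun c _ => ?_
  rw [profileWeight, if_pos hj, hn, Nat.add_sub_cancel, Nat.add_sub_cancel,
    show a + 1 + c + 1 = c + (a + 2) by ring]
  have h : (((c + (a + 2)).choose (a + 1) * (a + 1) : ℕ) : ℝ)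
      = ((c + (a + 2)).choose a * (c + (a + 2) - a) : ℕ) :=
    congrArg _ (Nat.choose_succ_right_eq _ _)
  rw [show c + (a + 2) - a = c + 2 by omega] at h
  push_cast at h ⊢
  rw [← eq_div_iff (by positivity)] at h
  rw [h]
  field_simp
  ring

lemma sum_profileWeight_bottom_pos {N N' j : ℕ} (hj : j < N') (hjN : j < N) :
    0 < ∑ c ∈ range (N - j), (-1) ^ c * ((0 + c + 1).choose 0 : ℝ) * profileWeight N N' (c + 1) j
      := by
  obtain ⟨n, hn⟩ : ∃ n, N - j = n + 1 := ⟨N - j - 1, by omega⟩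
  have h : 0 < ∑ c ∈ range (n + 1), (-1) ^ c * (n.choose c : ℝ) * (1 / ((c : ℝ) + (1 : ℕ) + 1)) := by
    rw [alternating_sum_inv]
    positivity
  rw [hn]
  refine h.trans_eq (sum_congr rfl fun c _ => ?_)
  rw [profileWeight, if_pos hj, hn, Nat.add_sub_cancel, Nat.add_sub_cancel, Nat.choose_zero_right]
  push_cast
  ring

/-- The defining relations of the bottom- or top-sparse columns have a one-dimensional solution
space. -/
lemma exists_eq_mul_of_alternating_sum_eq_zero {n : ℕ} {q w : ℕ → ℝ} (s : Finset ℕ)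
    (hs : n ≤ s.card) (hw : w (n + 1) ≠ 0)
    (hq0 : ∀ a ∈ s, ∑ c ∈ range (n + 1), (-1) ^ c * ((a + c + 1).choose a : ℝ) * q (c + 1) = 0)
    (hw0 : ∀ a ∈ s, ∑ c ∈ range (n + 1), (-1) ^ c * ((a + c + 1).choose a : ℝ) * w (c + 1) = 0) :
    ∃ t, ∀ b ∈ Icc 1 (n + 1), q b = t * w b := by
  refine ⟨q (n + 1) / w (n + 1), fun b hb => ?_⟩
  set t := q (n + 1) / w (n + 1) with ht
  have hlast : q (n + 1) - t * w (n + 1) = 0 := by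
    rw [ht]
    field_simp
    ring
  have h := eq_zero_of_sum_choose_eq_zero (n := n) (z := fun b => (-1) ^ b * (q b - t * w b)) s hs ?_
  · rcases eq_or_ne b (n + 1) with rfl | hbn
    · exact sub_eq_zero.1 hlast
    · have h1 := h b (mem_Icc.2 (by have := mem_Icc.1 hb; omega))
      have h2 : (-1 : ℝ) ^ b ≠ 0 := by positivity
      simpa [h2, sub_eq_zero] using h1
  · intro a ha
    have e : ∑ c ∈ range (n + 1),
        (-1) ^ c * ((a + c + 1).choose a : ℝ) * (q (c + 1) - t * w (c + 1)) = 0 := by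
      simp only [mul_sub, sum_sub_distrib, hq0 a ha, zero_sub, neg_eq_zero]
      rw [← mul_zero t, ← hw0 a ha, mul_sum]
      exact sum_congr rfl fun c _ => by ring
    rw [sum_range_succ, hlast, mul_zero, add_zero] at e
    rw [← neg_eq_zero, ← e, ← sum_neg_distrib]
    refine sum_nbij' (fun b => b - 1) (fun c => c + 1) ?_ ?_ ?_ ?_ ?_
    · intro b hb
      simp only [mem_Icc, mem_range] at hb ⊢
      omega
    · intro c hc
      simp only [mem_Icc, mem_range] at hc ⊢
      omega
    · intro b hb
      have := mem_Icc.1 hb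
      omega
    · intro c _
      omega
    · intro b hb
      obtain ⟨c, rfl⟩ : ∃ c, b = c + 1 := ⟨b - 1, by have := mem_Icc.1 hb; omega⟩
      rw [Nat.add_sub_cancel, ← add_assoc]
      ring

/-! ### H-matrices with the given profile -/

/-- The alternating sums over the Q-functions of column `j` through which the certificate matrix
depends on this column. -/
def altPairing {n : ℕ} (N : ℕ) (H : Matrix (Fin n) (Fin n) ℝ) (a j : ℕ) : ℝ :=
  ∑ b ∈ range N, (-1) ^ b * ((a + b).choose a : ℝ) * qVec N H b j

lemma certMatrix_eq_sum_altPairing {n : ℕ} (N : ℕ) (H : Matrix (Fin n) (Fin n) ℝ) (k j : ℕ) :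
    certMatrix N H k j
      = N * ∑ a ∈ range N, (-1) ^ a * qVec N H a k * altPairing N H a j := by
  unfold certMatrix altPairing
  congr 1
  refine sum_congr rfl fun a _ => ?_
  rw [mul_sum]
  exact sum_congr rfl fun b _ => by ring

lemma altPairing_eq {n N : ℕ} (H : Matrix (Fin n) (Fin n) ℝ) (a : ℕ) {j : ℕ} (hj : 1 ≤ j)
    (hjN : j < N) :
    altPairing N H a j
      = -∑ c ∈ range (N - j), (-1) ^ c * ((a + c + 1).choose a : ℝ) * qVec N H (c + 1) j := by
  obtain ⟨M, rfl⟩ : ∃ M, N = M + 1 := ⟨N - 1, by omega⟩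
  rw [altPairing, sum_range_succ', qVec, if_neg hjN.ne, mul_zero, add_zero, ← sum_neg_distrib]
  symm
  refine sum_subset_zero_on_sdiff ?_ ?_ ?_
  · intro c hc
    simp only [mem_range] at hc ⊢
    omega
  · intro c hc
    simp only [mem_range, mem_sdiff] at hc
    rw [qVec_eq_zero _ H (by omega), mul_zero]
  · intro c _
    rw [← add_assoc]
    ring

section

variable {N N' : ℕ} {H : Matrix (Fin (N - 1)) (Fin (N - 1)) ℝ}

lemma hasProfile_iff : HasProfile N N' H ↔
    ∀ j, 1 ≤ j → j < N → ∀ k, 1 ≤ k → qVec N H k j = profile N N' k j := by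
  constructor
  · intro h j hj hjN k hk
    rcases le_or_gt k (N - j) with hkj | hkj
    · obtain ⟨m, rfl⟩ : ∃ m, k = m + 1 := ⟨k - 1, by omega⟩
      rw [qVec_succ_eq_Q H m hj, h j hj (by omega) _ hk hkj]
    · rw [qVec_eq_zero N H (by omega), profile_eq_zero (by omega) hjN]
  · intro h j hj hjN k hk hkj
    obtain ⟨m, rfl⟩ : ∃ m, k = m + 1 := ⟨k - 1, by omega⟩
    rw [← qVec_succ_eq_Q H m hj, h j hj (by omega) _ hk]

/-- For `m ≥ 1` the last coordinate of the vector of Q-functions is zero and can be dropped. -/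
lemma P_eq_sum_qVec_lt (hN : 1 ≤ N) {m : ℕ} (hm : 1 ≤ m) :
    P H (N - 1) m = ∑ j ∈ Icc 1 (N - 1), qVec N H m j := by
  rw [P_eq_sum_qVec H hN]
  symm
  refine sum_subset (fun j hj => ?_) fun j hj hj' => ?_
  · simp only [mem_Icc] at hj ⊢
    omega
  · simp only [mem_Icc] at hj hj'
    exact qVec_eq_zero N H (by omega)

lemma HasProfile.hInvariance (hN'₁ : 1 ≤ N') (hN'₂ : N' ≤ N) (h : HasProfile N N' H) :
    HInvariance N H := by
  intro m hm hmN
  rw [P_eq_sum_qVec_lt (by omega) hm, ← sum_profile hN'₁ hN'₂ (by omega) hm]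
  refine sum_congr rfl fun j hj => ?_
  have := mem_Icc.1 hj
  exact hasProfile_iff.1 h j this.1 (by omega) m hm

lemma HasProfile.altPairing_eq (h : HasProfile N N' H) (a : ℕ) {j : ℕ} (hj : 1 ≤ j) (hjN : j < N) :
    altPairing N H a j = -(profileScale N N' j *
      ∑ c ∈ range (N - j), (-1) ^ c * ((a + c + 1).choose a : ℝ) * profileWeight N N' (c + 1) j) := by
  rw [HMatrix.altPairing_eq H a hj hjN, mul_sum]
  congr 1
  refine sum_congr rfl fun c _ => ?_
  rw [hasProfile_iff.1 h j hj hjN _ (by omega), profile_eq_scale_mul_weight]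
  ring

lemma HasProfile.certMatrix_bottom_eq_zero (h : HasProfile N N' H) {k j : ℕ} (hj : 1 ≤ j)
    (hj' : j < N') (hjk : j < k) (hk : k < N) : certMatrix N H k j = 0 := by
  rw [certMatrix_eq_sum_altPairing, sum_eq_zero, mul_zero]
  intro a _
  rcases Nat.eq_zero_or_pos a with rfl | ha
  · rw [qVec, if_neg hk.ne]
    ring
  · rcases lt_or_ge a (N - j) with haj | haj
    · rw [h.altPairing_eq a hj (by omega), sum_profileWeight_bottom_eq_zero hj' ha haj]
      ring
    · rw [qVec_eq_zero N H (by omega)]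
      ring

lemma HasProfile.certMatrix_top_eq_zero (h : HasProfile N N' H) {k j : ℕ} (hj : 1 ≤ j)
    (hj' : N' ≤ j) (hjk : j + 1 < k) (hk : k ≤ N) : certMatrix N H k j = 0 := by
  rw [certMatrix_eq_sum_altPairing, sum_eq_zero, mul_zero]
  intro a _
  rcases lt_or_ge (a + 1) (N - j) with haj | haj
  · rw [h.altPairing_eq a hj (by omega), sum_profileWeight_top_eq_zero hj' haj]
    ring
  · rw [qVec_eq_zero N H (by omega)]
    ring

lemma HasProfile.certMatrix_bottom_neg (hN' : N' ≤ N) (h : HasProfile N N' H) {j : ℕ} (hj : 1 ≤ j)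
    (hj' : j < N') : certMatrix N H N j < 0 := by
  have hN : (0 : ℝ) < N := by exact_mod_cast (by omega : 0 < N)
  rw [certMatrix_eq_sum_altPairing, sum_eq_single_of_mem 0 (mem_range.2 (by omega)),
    h.altPairing_eq 0 hj (by omega), qVec, if_pos rfl]
  · have := mul_pos (profileScale_pos (j := j) hN')
      (sum_profileWeight_bottom_pos hj' (by omega : j < N))
    nlinarith
  · intro a _ ha
    rw [qVec_eq_zero N H (by omega)]
    ring

lemma HasProfile.certMatrix_top_neg (hN' : N' ≤ N) (h : HasProfile N N' H) {j : ℕ} (hj : 1 ≤ j)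
    (hj' : N' ≤ j) (hjN : j < N) : certMatrix N H (j + 1) j < 0 := by
  have hN : (0 : ℝ) < N := by exact_mod_cast (by omega : 0 < N)
  obtain ⟨n, hn⟩ : ∃ n, N - j = n + 1 := ⟨N - j - 1, by omega⟩
  have hq : 0 < qVec N H n (j + 1) := by
    rcases Nat.eq_zero_or_pos n with rfl | hn0
    · rw [qVec, if_pos (by omega)]
      exact one_pos
    · rw [hasProfile_iff.1 h (j + 1) (by omega) (by omega) n hn0, show n = N - (j + 1) by omega]
      exact profile_pos hN'
  rw [certMatrix_eq_sum_altPairing, sum_eq_single_of_mem n (mem_range.2 (by omega)),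
    h.altPairing_eq n hj hjN, sum_profileWeight_top hj' hn]
  · have h1 : ((-1 : ℝ) ^ n) * (-1) ^ n = 1 := by rw [← mul_pow]; simp
    have := mul_pos hN (mul_pos (profileScale_pos (j := j) hN') hq)
    calc _ = -(((-1 : ℝ) ^ n * (-1) ^ n) * (N * (profileScale N N' j * qVec N H n (j + 1)))) := by
          ring
      _ < 0 := by rw [h1]; linarith
  · intro a _ ha
    rcases lt_or_gt_of_ne ha with ha | ha
    · rw [h.altPairing_eq a hj hjN, sum_profileWeight_top_eq_zero hj' (by omega)]
      ring
    · rw [qVec_eq_zero N H (by omega)]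
      ring

/-! ### Sparse certificates determine the profile -/

/-- Vanishing certificates in column `j` make the alternating sums of this column vanish, one after
the other, as the border entries of the Q-functions are nonzero. -/
lemma altPairing_eq_zero_of_certMatrix_eq_zero (hN : 2 ≤ N) (hH : HInvariance N H) {l u j : ℕ}
    (hl : l ≤ 1) (hu : u < N) (h : ∀ a, l ≤ a → a ≤ u → certMatrix N H (N - a) j = 0) :
    ∀ a, l ≤ a → a ≤ u → altPairing N H a j = 0 := by
  intro a
  induction a using Nat.strong_induction_on with
  | _ a ih =>
    intro hla hau
    have hN0 : (N : ℝ) ≠ 0 := by positivity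
    have hc := h a hla hau
    rw [certMatrix_eq_sum_altPairing, sum_eq_single_of_mem a (mem_range.2 (by omega))] at hc
    · have hq := qVec_diagonal_ne_zero H hH hN (k := N - a) (by omega) (by omega)
      rw [show N - (N - a) = a by omega] at hq
      have h1 : (-1 : ℝ) ^ a ≠ 0 := by positivity
      simpa [hN0, hq, h1] using hc
    · intro b _ hb
      rcases lt_or_gt_of_ne hb with hb | hb
      · rcases lt_or_ge b l with hbl | hbl
        · obtain rfl : b = 0 := by omega
          rw [qVec, if_neg (by omega)]
          ring
        · rw [ih b hb hbl (by omega), mul_zero]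
      · rw [qVec_eq_zero N H (by omega)]
        ring

/-- The column scales are determined by the values `P(N-1, m; H)`, as the weights are triangular. -/
lemma scale_unique {t t' : ℕ → ℝ}
    (h : ∀ m, 1 ≤ m → m ≤ N - 1 → ∑ j ∈ Icc 1 (N - 1), t j * profileWeight N N' m j
      = ∑ j ∈ Icc 1 (N - 1), t' j * profileWeight N N' m j) :
    ∀ j, 1 ≤ j → j ≤ N - 1 → t j = t' j := by
  intro j
  induction j using Nat.strong_induction_on with
  | _ j ih =>
    intro hj hjN
    have e := h (N - j) (by omega) (by omega)
    rw [← sub_eq_zero, ← sum_sub_distrib, sum_eq_single_of_mem j (mem_Icc.2 ⟨hj, hjN⟩), ← sub_mul]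
      at e
    · have := (profileWeight_pos (N := N) (N' := N') (j := j)).ne'
      exact sub_eq_zero.1 ((mul_eq_zero.1 e).resolve_right this)
    · intro i hi hij
      have hi := mem_Icc.1 hi
      rcases lt_or_gt_of_ne hij with hlt | hgt
      · rw [ih i hlt hi.1 hi.2, sub_self]
      · rw [profileWeight_eq_zero (by omega) (by omega)]
        ring

/-- Sparsity fixes each column of Q-functions up to a scale, and H-invariance fixes the scales. -/
lemma hasProfile_of_sparse (hN'₁ : 1 ≤ N') (hN'₂ : N' ≤ N) (hN : 2 ≤ N) (hH : HInvariance N H)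
    (hbot : ∀ k j, 1 ≤ j → j < N' → j < k → k < N → certMatrix N H k j = 0)
    (htop : ∀ k j, 1 ≤ j → N' ≤ j → j + 1 < k → k ≤ N → certMatrix N H k j = 0) :
    HasProfile N N' H := by
  have key (j : ℕ) (hj : 1 ≤ j ∧ j < N) :
      ∃ t, ∀ b, 1 ≤ b → qVec N H b j = t * profileWeight N N' b j := by
    obtain ⟨hj, hjN⟩ := hj
    obtain ⟨n, hn⟩ : ∃ n, N - j = n + 1 := ⟨N - j - 1, by omega⟩
    have hw : profileWeight N N' (n + 1) j ≠ 0 := hn ▸ profileWeight_pos.ne'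
    obtain ⟨s, hs, hq0, hw0⟩ : ∃ s : Finset ℕ, n ≤ s.card ∧
        (∀ a ∈ s, altPairing N H a j = 0) ∧ ∀ a ∈ s, ∑ c ∈ range (N - j),
          (-1) ^ c * ((a + c + 1).choose a : ℝ) * profileWeight N N' (c + 1) j = 0 := by
      rcases lt_or_ge j N' with hj' | hj'
      · refine ⟨Icc 1 n, by simp, fun a ha => ?_, fun a ha => ?_⟩
        · have ha := mem_Icc.1 ha
          exact altPairing_eq_zero_of_certMatrix_eq_zero hN hH le_rfl (by omega)
            (fun b hb hb' => hbot _ _ hj hj' (by omega) (by omega)) a ha.1 ha.2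
        · have ha := mem_Icc.1 ha
          exact sum_profileWeight_bottom_eq_zero hj' ha.1 (by omega)
      · rcases Nat.eq_zero_or_pos n with rfl | hn0
        · exact ⟨∅, by simp⟩
        refine ⟨range n, by simp, fun a ha => ?_, fun a ha => ?_⟩
        · have ha := mem_range.1 ha
          exact altPairing_eq_zero_of_certMatrix_eq_zero (u := n - 1) hN hH zero_le_one (by omega)
            (fun b hb hb' => htop _ _ hj hj' (by omega) (by omega)) a (by omega) (by omega)
        · have ha := mem_range.1 ha
          exact sum_profileWeight_top_eq_zero hj' (by omega)
    obtain ⟨t, ht⟩ := exists_eq_mul_of_alternating_sum_eq_zero (q := fun b => qVec N H b j)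
      (w := fun b => profileWeight N N' b j) s hs hw
      (fun a ha => by
        have := hq0 a ha
        rwa [altPairing_eq H a hj hjN, neg_eq_zero, hn] at this)
      (fun a ha => by rw [← hn]; exact hw0 a ha)
    refine ⟨t, fun b hb => ?_⟩
    rcases le_or_gt b (n + 1) with hbn | hbn
    · exact ht b (mem_Icc.2 ⟨hb, hbn⟩)
    · rw [qVec_eq_zero N H (by omega), profileWeight_eq_zero (by omega) hjN, mul_zero]
  choose! t ht using key
  have hscale : ∀ j, 1 ≤ j → j ≤ N - 1 → t j = profileScale N N' j := by
    refine scale_unique (N' := N') fun m hm hmN => ?_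
    have h1 := sum_profile hN'₁ hN'₂ (by omega) hm
    rw [← hH m hm hmN, P_eq_sum_qVec_lt (by omega) hm] at h1
    simp only [profile_eq_scale_mul_weight] at h1
    rw [h1]
    refine sum_congr rfl fun j hj => ?_
    have hj := mem_Icc.1 hj
    rw [ht j ⟨hj.1, by omega⟩ m hm]
  rw [hasProfile_iff]
  intro j hj hjN k hk
  rw [ht j ⟨hj, hjN⟩ k hk, hscale j hj (by omega), profile_eq_scale_mul_weight]

end

/-! ### Recovering the H-matrix from its Q-functions -/

lemma sum_Icc_mul_eq_of_eq_zero {N : ℕ} {p κ : ℕ → ℝ} {k : ℕ} (hk : 1 ≤ k) (hkN : k ≤ N)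
    (hp : ∀ i, k < i → p i = 0) :
    ∑ i ∈ Icc 1 N, p i * κ i = ∑ i ∈ Ico 1 k, p i * κ i + p k * κ k := by
  rw [← sum_Ico_succ_top hk]
  symm
  refine sum_subset (fun i hi => ?_) fun i hi hi' => ?_
  · simp only [mem_Icc, mem_Ico] at hi ⊢
    omega
  · simp only [mem_Icc, mem_Ico] at hi hi'
    rw [hp i (by omega), zero_mul]

lemma entry_eq_colSum_sub {n : ℕ} (H : Matrix (Fin n) (Fin n) ℝ) {l j : ℕ} (h : j ≤ l) :
    entry H l j = colSum H (l + 1) j - colSum H l j := by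
  rw [colSum, colSum, sum_Ico_succ_top h, add_sub_cancel_left]

/-- The column sums of a column solve a triangular linear system whose coefficients are
Q-functions. -/
lemma lowerTriangular_eq_of_qVec_eq {N : ℕ} {H H' : Matrix (Fin (N - 1)) (Fin (N - 1)) ℝ}
    (hH : LowerTriangular H) (hH' : LowerTriangular H')
    (h0 : ∀ k, 1 ≤ k → k ≤ N → qVec N H (N - k) k ≠ 0)
    (h : ∀ a k, 1 ≤ k → k ≤ N → qVec N H a k = qVec N H' a k) : H = H' := by
  have hcol (j : ℕ) (hj : 1 ≤ j) (k : ℕ) : k ≤ N → colSum H k j = colSum H' k j := by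
    induction k using Nat.strong_induction_on with
    | _ k ih =>
      intro hkN
      rcases le_or_gt k j with hkj | hkj
      · rw [colSum_eq_zero H hkj, colSum_eq_zero H' hkj]
      · have e := h (N - k + 1) j hj (by omega)
        have h1 : ∀ i, k < i → qVec N H (N - k) i = 0 := fun i hi => qVec_eq_zero N H (by omega)
        have h2 : ∀ i, k < i → qVec N H' (N - k) i = 0 := fun i hi => qVec_eq_zero N H' (by omega)
        rw [qVec, qVec, sum_Icc_mul_eq_of_eq_zero (by omega) hkN h1,
          sum_Icc_mul_eq_of_eq_zero (by omega) hkN h2] at e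
        have e2 : ∑ i ∈ Ico 1 k, qVec N H (N - k) i * colSum H i j
            = ∑ i ∈ Ico 1 k, qVec N H' (N - k) i * colSum H' i j := by
          refine sum_congr rfl fun i hi => ?_
          have := mem_Ico.1 hi
          rw [ih i this.2 (by omega), h _ i this.1 (by omega)]
        rw [e2, ← h (N - k) k (by omega) hkN] at e
        exact mul_left_cancel₀ (h0 k (by omega) hkN) (add_left_cancel e)
  ext i j
  rcases lt_or_ge i j with hij | hij
  · rw [hH i j hij, hH' i j hij]
  · have hij' : (j : ℕ) ≤ i := hij
    have e : entry H (i + 1) (j + 1) = entry H' (i + 1) (j + 1) := by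
      rw [entry_eq_colSum_sub H (by omega), entry_eq_colSum_sub H' (by omega),
        hcol _ (by omega) _ (by omega), hcol _ (by omega) _ (by omega)]
    have hr : (1 ≤ (i : ℕ) + 1 ∧ (i : ℕ) + 1 ≤ N - 1) ∧ 1 ≤ (j : ℕ) + 1 ∧ (j : ℕ) + 1 ≤ N - 1 := by
      omega
    rw [entry, dif_pos hr, entry, dif_pos hr] at e
    exact e

/-- Forward substitution for the column sums of the `j`-th column of an H-matrix with Q-functions
`p a k`. -/
noncomputable def solveColumn (N : ℕ) (p : ℕ → ℕ → ℝ) (j : ℕ) : ℕ → ℝ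
  | k => if k ≤ j then 0 else
      (p (N - k + 1) j - ∑ i : Fin k, p (N - k) i * solveColumn N p j i) / p (N - k) k
  termination_by k => k
  decreasing_by exact i.isLt

lemma solveColumn_eq_zero {N : ℕ} {p : ℕ → ℕ → ℝ} {j k : ℕ} (h : k ≤ j) :
    solveColumn N p j k = 0 := by
  rw [solveColumn, if_pos h]

lemma sum_mul_solveColumn {N : ℕ} {p : ℕ → ℕ → ℝ} {j k : ℕ} (hjk : j < k) (hkN : k ≤ N)
    (hp : ∀ i, k < i → p (N - k) i = 0) (hp0 : p (N - k) k ≠ 0) :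
    ∑ i ∈ Icc 1 N, p (N - k) i * solveColumn N p j i = p (N - k + 1) j := by
  rw [sum_Icc_mul_eq_of_eq_zero (p := p (N - k)) (by omega) hkN hp]
  conv_lhs => rw [solveColumn.eq_1 N p j k, if_neg (by omega)]
  rw [mul_div_cancel₀ _ hp0,
    Fin.sum_univ_eq_sum_range (fun i => p (N - k) i * solveColumn N p j i) k, range_eq_Ico,
    sum_eq_sum_Ico_succ_bot (by omega : 0 < k), solveColumn_eq_zero (Nat.zero_le j)]
  ring

/-- The lower triangular matrix whose column sums are `κ j k`. -/
def ofColSum (N : ℕ) (κ : ℕ → ℕ → ℝ) : Matrix (Fin (N - 1)) (Fin (N - 1)) ℝ :=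
  fun i j => if j ≤ i then κ (j + 1) (i + 2) - κ (j + 1) (i + 1) else 0

lemma lowerTriangular_ofColSum (N : ℕ) (κ : ℕ → ℕ → ℝ) : LowerTriangular (ofColSum N κ) :=
  fun _ _ h => if_neg (not_le.2 h)

lemma colSum_ofColSum {N : ℕ} {κ : ℕ → ℕ → ℝ} {j k : ℕ} (hj : 1 ≤ j) (hjk : j ≤ k) (hk : k ≤ N)
    (h0 : κ j j = 0) : colSum (ofColSum N κ) k j = κ j k := by
  induction k, hjk using Nat.le_induction with
  | base => rw [colSum_eq_zero _ le_rfl, h0]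
  | succ k hjk ih =>
    have e := entry_eq_colSum_sub (ofColSum N κ) hjk
    rw [ih (by omega)] at e
    rw [sub_eq_iff_eq_add.1 e.symm, entry, dif_pos (by omega), ofColSum,
      if_pos (Fin.mk_le_mk.2 (by omega))]
    simp only
    rw [show j - 1 + 1 = j by omega, show k - 1 + 2 = k + 1 by omega,
      show k - 1 + 1 = k by omega, sub_add_cancel]

/-- The prescribed Q-functions, extended by the values at `a = 0` and `k = N`. -/
noncomputable def profileVec (N N' a k : ℕ) : ℝ :=
  if k = N then (if a = 0 then 1 else 0)
  else if a = 0 ∨ N < k then 0 else profile N N' a k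

lemma profileVec_eq_zero {N N' a k : ℕ} (h : N < a + k) : profileVec N N' a k = 0 := by
  unfold profileVec
  split_ifs with h1 h2 h3
  · omega
  · rfl
  · rfl
  · exact profile_eq_zero h (by omega)

lemma profileVec_diagonal_ne_zero {N N' k : ℕ} (hN' : N' ≤ N) (hk : k ≤ N) :
    profileVec N N' (N - k) k ≠ 0 := by
  unfold profileVec
  split_ifs with h1 h2 h3
  · exact one_ne_zero
  · omega
  · omega
  · exact (profile_pos hN').ne'

lemma hasProfile_iff_profileVec {N N' : ℕ} {H : Matrix (Fin (N - 1)) (Fin (N - 1)) ℝ} :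
    HasProfile N N' H ↔ ∀ a k, 1 ≤ k → k ≤ N → qVec N H a k = profileVec N N' a k := by
  rw [hasProfile_iff]
  constructor
  · intro h a k hk hkN
    unfold profileVec
    split_ifs with h1 h2 h3
    · rw [h1, h2, qVec, if_pos rfl]
    · exact qVec_eq_zero N H (by omega)
    · obtain rfl : a = 0 := by omega
      rw [qVec, if_neg h1]
    · exact h k hk (by omega) a (by omega)
  · intro h j hj hjN k hk
    rw [h k j hj hjN.le, profileVec, if_neg hjN.ne, if_neg (by omega)]

/-- Forward substitution in each column gives existence, and the nonzero border entries of the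
profile give uniqueness. -/
lemma existsUnique_hasProfile {N N' : ℕ} (hN' : N' ≤ N) :
    ∃! H : Matrix (Fin (N - 1)) (Fin (N - 1)) ℝ, LowerTriangular H ∧ HasProfile N N' H := by
  refine existsUnique_of_exists_of_unique ⟨ofColSum N (solveColumn N (profileVec N N')),
    lowerTriangular_ofColSum _ _, ?_⟩ ?_
  · rw [hasProfile_iff_profileVec]
    intro a
    induction a with
    | zero =>
      intro k hk hkN
      rw [qVec, profileVec]
      simp
    | succ a ih =>
      intro j hj hjN
      rcases le_or_gt (a + 1 + j) N with haj | haj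
      · rw [qVec]
        have e := sum_mul_solveColumn (p := profileVec N N') (j := j) (k := N - a) (N := N)
          (by omega) (by omega) (fun i hi => profileVec_eq_zero (by omega))
          (profileVec_diagonal_ne_zero hN' (by omega))
        rw [show N - (N - a) = a by omega] at e
        rw [← e]
        refine sum_congr rfl fun k hk => ?_
        have hk := mem_Icc.1 hk
        rw [ih k hk.1 hk.2]
        congr 1
        rcases le_or_gt j k with hjk | hjk
        · exact colSum_ofColSum hj hjk hk.2 (solveColumn_eq_zero le_rfl)
        · rw [colSum_eq_zero _ hjk.le, solveColumn_eq_zero hjk.le]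
      · rw [qVec_eq_zero _ _ (by omega), profileVec_eq_zero (by omega)]
  · rintro H H' ⟨hH, hp⟩ ⟨hH', hp'⟩
    rw [hasProfile_iff_profileVec] at hp hp'
    refine lowerTriangular_eq_of_qVec_eq hH hH' (fun k hk hkN => ?_) fun a k hk hkN => ?_
    · rw [hp _ k hk hkN]
      exact profileVec_diagonal_ne_zero hN' hkN
    · rw [hp a k hk hkN, hp' a k hk hkN]

/-! ### The convergence rate from nonnegative certificates -/

/-- If `T` is nonexpansive, then `(I - T) / 2` evaluated at `u` is a value at `(u + T u) / 2` of a
monotone operator; the inner products weighted by the certificates are therefore nonnegative. -/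
lemma inner_resolvent_nonneg {V : Type*} [NormedAddCommGroup V] [InnerProductSpace ℝ V]
    {T : V → V} (hT : LipschitzWith 1 T) (u v : V) :
    0 ≤ inner ℝ ((u - (1 / 2 : ℝ) • (u - T u)) - (v - (1 / 2 : ℝ) • (v - T v)))
      ((1 / 2 : ℝ) • (u - T u) - (1 / 2 : ℝ) • (v - T v)) := by
  have h := hT.dist_le_mul u v
  rw [dist_eq_norm, dist_eq_norm, NNReal.coe_one, one_mul] at h
  have e : inner ℝ ((u - (1 / 2 : ℝ) • (u - T u)) - (v - (1 / 2 : ℝ) • (v - T v)))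
      ((1 / 2 : ℝ) • (u - T u) - (1 / 2 : ℝ) • (v - T v))
      = (‖u - v‖ ^ 2 - ‖T u - T v‖ ^ 2) / 4 := by
    rw [show (u - (1 / 2 : ℝ) • (u - T u)) - (v - (1 / 2 : ℝ) • (v - T v))
        = (1 / 2 : ℝ) • ((u - v) + (T u - T v)) by module,
      show (1 / 2 : ℝ) • (u - T u) - (1 / 2 : ℝ) • (v - T v)
        = (1 / 2 : ℝ) • ((u - v) - (T u - T v)) by module,
      real_inner_smul_left, real_inner_smul_right, inner_add_left, inner_sub_right (u - v) (u - v),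
      inner_sub_right (T u - T v) (u - v), real_inner_self_eq_norm_sq, real_inner_self_eq_norm_sq,
      real_inner_comm (u - v)]
    ring
  rw [e]
  have := norm_nonneg (T u - T v)
  nlinarith [norm_nonneg (u - v)]

/-- The iterates of the algorithm of `H` are the formal iterates for `g_k = (y_{k-1} - T y_{k-1}) /
2`. At `k = 0` the value of `g` is irrelevant. -/
lemma iter_toAlgorithm {n : ℕ} (H : Matrix (Fin n) (Fin n) ℝ) {d : ℕ}
    (T : EuclideanSpace ℝ (Fin d) → EuclideanSpace ℝ (Fin d)) (y₀ : EuclideanSpace ℝ (Fin d))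
    (k : ℕ) :
    iter (toAlgorithm H d) T y₀ k = yVec H y₀ (fun i => (1 / 2 : ℝ) •
      (iter (toAlgorithm H d) T y₀ (i - 1) - T (iter (toAlgorithm H d) T y₀ (i - 1)))) k := by
  induction k with
  | zero => rw [iter, yVec]
  | succ k ih =>
    rw [yVec, ← ih, iter]
    simp only [toAlgorithm, Fin.val_last]
    congr 1
    change ∑ j : Fin (k + 1), entry H (k + 1) (j.val + 1) •
      (iter (toAlgorithm H d) T y₀ j.val - T (iter (toAlgorithm H d) T y₀ j.val)) = _
    rw [Fin.sum_univ_eq_sum_range (fun j => entry H (k + 1) (j + 1) •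
      (iter (toAlgorithm H d) T y₀ j - T (iter (toAlgorithm H d) T y₀ j))) (k + 1)]
    refine sum_nbij' (fun j => j + 1) (fun j => j - 1) ?_ ?_ ?_ ?_ ?_
    · intro j hj
      simp only [mem_Icc, mem_range] at hj ⊢
      omega
    · intro j hj
      simp only [mem_Icc, mem_range] at hj ⊢
      omega
    · intro j _
      rfl
    · intro j hj
      have := mem_Icc.1 hj
      omega
    · intro j _
      rw [Nat.add_sub_cancel, smul_smul]
      congr 1
      ring

lemma residual_le_of_certificate {N : ℕ} (hN : 1 ≤ N) {H : Matrix (Fin (N - 1)) (Fin (N - 1)) ℝ}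
    {lam : ℕ → ℕ → ℝ} (hlam : IsCertificate N H lam)
    (hpos : ∀ k j, 1 ≤ j → j < k → k ≤ N → 0 ≤ lam k j) {d : ℕ}
    {T : EuclideanSpace ℝ (Fin d) → EuclideanSpace ℝ (Fin d)} {y₀ ystar : EuclideanSpace ℝ (Fin d)}
    (hT : LipschitzWith 1 T) (hfix : T ystar = ystar) :
    ‖iter (toAlgorithm H d) T y₀ (N - 1) - T (iter (toAlgorithm H d) T y₀ (N - 1))‖ ^ 2
      ≤ 4 * ‖y₀ - ystar‖ ^ 2 / (N : ℝ) ^ 2 := by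
  set y := iter (toAlgorithm H d) T y₀ with hy
  set g : ℕ → EuclideanSpace ℝ (Fin d) := fun i => (1 / 2 : ℝ) • (y (i - 1) - T (y (i - 1))) with hg
  have hyV (k : ℕ) : yVec H y₀ g k = y k := (iter_toAlgorithm H T y₀ k).symm
  have hx (k : ℕ) : xVec H y₀ g k = y (k - 1) - g k := by rw [xVec, hyV]
  have hsum : 0 ≤ ∑ k ∈ Icc 1 N, ∑ j ∈ Ico 1 k,
      lam k j * inner ℝ (xVec H y₀ g k - xVec H y₀ g j) (g k - g j) := by
    refine sum_nonneg fun k hk => sum_nonneg fun j hj => ?_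
    have hk := mem_Icc.1 hk
    have hj := mem_Ico.1 hj
    refine mul_nonneg (hpos k j hj.1 hj.2 hk.2) ?_
    rw [hx, hx]
    exact inner_resolvent_nonneg hT _ _
  have hstar : 0 ≤ inner ℝ (xVec H y₀ g N - ystar) (g N) := by
    have := inner_resolvent_nonneg hT (y (N - 1)) ystar
    rw [hfix, sub_self, smul_zero, sub_zero, sub_zero] at this
    rwa [hx]
  have hid := hlam.2 d y₀ g
  have hcs := real_inner_le_norm (g N) (y₀ - ystar)
  have hsplit : inner ℝ (g N) (xVec H y₀ g N - y₀)
      = inner ℝ (xVec H y₀ g N - ystar) (g N) - inner ℝ (g N) (y₀ - ystar) := by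
    rw [real_inner_comm (g N) (xVec H y₀ g N - ystar), ← inner_sub_right]
    congr 1
    abel
  have hN0 : (0 : ℝ) < N := by exact_mod_cast hN
  have hle : (N : ℝ) * ‖g N‖ ^ 2 ≤ ‖g N‖ * ‖y₀ - ystar‖ := by linarith
  have hle' : (N : ℝ) * ‖g N‖ ≤ ‖y₀ - ystar‖ := by
    rcases (norm_nonneg (g N)).eq_or_lt with h0 | h0
    · rw [← h0, mul_zero]
      exact norm_nonneg _
    · refine le_of_mul_le_mul_left ?_ h0
      linarith
  have hr : y (N - 1) - T (y (N - 1)) = (2 : ℝ) • g N := by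
    simp only [hg, smul_smul]
    norm_num
  rw [hr, norm_smul, Real.norm_two, le_div_iff₀ (by positivity)]
  have h2 : ((N : ℝ) * ‖g N‖) ^ 2 ≤ ‖y₀ - ystar‖ ^ 2 := by gcongr
  nlinarith

/-! ### The resisting oracle -/

section

variable {d : ℕ}

/-- Operators that agree on the first `m` queries yield the same queries up to `y_m`. -/
lemma iter_congr (A : Algorithm d) {T T' : EuclideanSpace ℝ (Fin d) → EuclideanSpace ℝ (Fin d)}
    {y₀ : EuclideanSpace ℝ (Fin d)} {m : ℕ} (h : ∀ i, i < m → T' (iter A T y₀ i) = T (iter A T y₀ i))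
    {k : ℕ} (hk : k ≤ m) : iter A T' y₀ k = iter A T y₀ k := by
  induction k using Nat.strong_induction_on with
  | _ k ih =>
    cases k with
    | zero => rw [iter, iter]
    | succ k =>
      rw [iter, iter]
      congr 1
      · funext i
        exact ih i.val i.isLt (by omega)
      · funext i
        rw [ih i.val i.isLt (by omega), h i.val (by omega)]

lemma exists_unit_orthogonal (s : Finset (EuclideanSpace ℝ (Fin d))) (hs : s.card < d) :
    ∃ u : EuclideanSpace ℝ (Fin d), ‖u‖ = 1 ∧ ∀ w ∈ s, inner ℝ u w = 0 := by
  set K := Submodule.span ℝ (s : Set (EuclideanSpace ℝ (Fin d)))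
  have hK : Module.finrank ℝ K < d := (finrank_span_finset_le_card s).trans_lt hs
  have hne : Kᗮ ≠ ⊥ := by
    intro h
    have := K.finrank_add_finrank_orthogonal
    rw [h, finrank_bot, finrank_euclideanSpace_fin] at this
    omega
  obtain ⟨x, hx, hx0⟩ := Submodule.exists_mem_ne_zero_of_ne_bot hne
  refine ⟨‖x‖⁻¹ • x, norm_smul_inv_norm hx0, fun w hw => ?_⟩
  rw [real_inner_smul_left, real_inner_comm,
    Submodule.inner_right_of_mem_orthogonal (Submodule.subset_span hw) hx, mul_zero]

/-- The part of the worst-case operator that is revealed by `v_0, …, v_m`: the affine map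
`y ↦ y + 2 v_0` with `v_i` moved to `v_{i+1}` for `i < m` by the linear part. -/
noncomputable def partialShift (v : ℕ → EuclideanSpace ℝ (Fin d)) (m : ℕ)
    (y : EuclideanSpace ℝ (Fin d)) : EuclideanSpace ℝ (Fin d) :=
  y - ∑ i ∈ range m, inner ℝ (v i) y • (v i - v (i + 1)) + (2 : ℝ) • v 0

/-- The worst-case operator: its linear part is the signed cyclic shift `v_0 ↦ v_1 ↦ ⋯ ↦ v_m ↦ -v_0`
on the span of the `v_i`, and the identity on the orthogonal complement. -/
noncomputable def cyclicShift (v : ℕ → EuclideanSpace ℝ (Fin d)) (m : ℕ)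
    (y : EuclideanSpace ℝ (Fin d)) : EuclideanSpace ℝ (Fin d) :=
  partialShift v m y - inner ℝ (v m) y • (v m + v 0)

/-- `v_0, …, v_m` are orthonormal. -/
def OrthonormalUpTo (v : ℕ → EuclideanSpace ℝ (Fin d)) (m : ℕ) : Prop :=
  ∀ i ≤ m, ∀ j ≤ m, inner ℝ (v i) (v j) = if i = j then (1 : ℝ) else 0

lemma partialShift_update {v : ℕ → EuclideanSpace ℝ (Fin d)} {m : ℕ}
    {u y : EuclideanSpace ℝ (Fin d)} (h : inner ℝ (v m) y = 0) :
    partialShift (Function.update v (m + 1) u) (m + 1) y = partialShift v m y := by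
  unfold partialShift
  rw [sum_range_succ, Function.update_of_ne (by omega : m ≠ m + 1), h, zero_smul, add_zero,
    Function.update_of_ne (by omega : 0 ≠ m + 1)]
  congr 2
  refine sum_congr rfl fun i hi => ?_
  have := mem_range.1 hi
  rw [Function.update_of_ne (by omega), Function.update_of_ne (by omega)]

lemma OrthonormalUpTo.update {v : ℕ → EuclideanSpace ℝ (Fin d)} {m : ℕ} (hv : OrthonormalUpTo v m)
    {u : EuclideanSpace ℝ (Fin d)} (hu : ‖u‖ = 1) (huv : ∀ i ≤ m, inner ℝ u (v i) = 0) :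
    OrthonormalUpTo (Function.update v (m + 1) u) (m + 1) := by
  intro i hi j hj
  rcases eq_or_ne i (m + 1) with rfl | hi'
  · rw [Function.update_self]
    rcases eq_or_ne j (m + 1) with rfl | hj'
    · rw [Function.update_self, real_inner_self_eq_norm_sq, hu, if_pos rfl, one_pow]
    · rw [Function.update_of_ne hj', huv j (by omega), if_neg hj'.symm]
  · rw [Function.update_of_ne hi']
    rcases eq_or_ne j (m + 1) with rfl | hj'
    · rw [Function.update_self, real_inner_comm, huv i (by omega), if_neg hi']
    · rw [Function.update_of_ne hj']
      exact hv i (by omega) j (by omega)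

/-- The directions `v_0, …, v_m` can be chosen, depending on the algorithm, such that no query
`y_k` has a component along a direction `v_i` with `k ≤ i`. -/
lemma exists_resisting_directions (A : Algorithm d) (m : ℕ) (hm : 2 * m < d) :
    ∃ v : ℕ → EuclideanSpace ℝ (Fin d), OrthonormalUpTo v m ∧
      ∀ i ≤ m, ∀ k ≤ i, inner ℝ (v i) (iter A (partialShift v m) 0 k) = 0 := by
  classical
  induction m with
  | zero =>
    obtain ⟨u, hu, -⟩ := exists_unit_orthogonal (d := d) ∅ (by simpa using hm)
    refine ⟨fun _ => u, fun i hi j hj => ?_, fun i hi k hk => ?_⟩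
    · rw [if_pos (by omega), real_inner_self_eq_norm_sq, hu, one_pow]
    · obtain rfl : k = 0 := by omega
      rw [iter, inner_zero_right]
  | succ m ih =>
    obtain ⟨v, hv, hvy⟩ := ih (by omega)
    set y := iter A (partialShift v m) 0 with hy
    obtain ⟨u, hu, hus⟩ := exists_unit_orthogonal
      ((range (m + 1)).image v ∪ (Ioc 0 (m + 1)).image y) (by
        refine (card_union_le _ _).trans_lt ?_
        have h1 := card_image_le (s := range (m + 1)) (f := v)
        have h2 := card_image_le (s := Ioc 0 (m + 1)) (f := y)
        rw [card_range] at h1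
        rw [Nat.card_Ioc] at h2
        omega)
    have huv : ∀ i ≤ m, inner ℝ u (v i) = 0 := fun i hi =>
      hus _ (mem_union_left _ (mem_image_of_mem v (mem_range.2 (by omega))))
    have huy : ∀ k ≤ m + 1, inner ℝ u (y k) = 0 := by
      intro k hk
      rcases Nat.eq_zero_or_pos k with rfl | hk0
      · rw [hy, iter, inner_zero_right]
      · exact hus _ (mem_union_right _ (mem_image_of_mem y (mem_Ioc.2 ⟨hk0, hk⟩)))
    have hit : ∀ k ≤ m + 1,
        iter A (partialShift (Function.update v (m + 1) u) (m + 1)) 0 k = y k := fun k hk =>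
      iter_congr A (fun i hi => partialShift_update (hvy m le_rfl i (by omega))) hk
    refine ⟨Function.update v (m + 1) u, hv.update hu huv, fun i hi k hk => ?_⟩
    rw [hit k (by omega)]
    rcases eq_or_ne i (m + 1) with rfl | hi'
    · rw [Function.update_self]
      exact huy k hk
    · rw [Function.update_of_ne hi']
      exact hvy i (by omega) k hk

lemma OrthonormalUpTo.norm_sum_sq {v : ℕ → EuclideanSpace ℝ (Fin d)} {m : ℕ}
    (hv : OrthonormalUpTo v m) (c : ℕ → ℝ) :
    ‖∑ i ∈ range (m + 1), c i • v i‖ ^ 2 = ∑ i ∈ range (m + 1), c i ^ 2 := by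
  rw [← real_inner_self_eq_norm_sq, sum_inner]
  refine sum_congr rfl fun i hi => ?_
  rw [inner_sum, sum_eq_single_of_mem i hi]
  · rw [real_inner_smul_left, real_inner_smul_right,
      hv i (by have := mem_range.1 hi; omega) i (by have := mem_range.1 hi; omega), if_pos rfl]
    ring
  · intro j hj hji
    rw [real_inner_smul_left, real_inner_smul_right,
      hv i (by have := mem_range.1 hi; omega) j (by have := mem_range.1 hj; omega),
      if_neg hji.symm]
    ring

/-- The cyclic shift is an isometry: its linear part maps an orthonormal family to another one with
the same span and fixes the orthogonal complement. -/
lemma lipschitzWith_cyclicShift {v : ℕ → EuclideanSpace ℝ (Fin d)} {m : ℕ}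
    (hv : OrthonormalUpTo v m) : LipschitzWith 1 (cyclicShift v m) := by
  refine LipschitzWith.of_dist_le_mul fun y z => ?_
  rw [NNReal.coe_one, one_mul, dist_eq_norm, dist_eq_norm]
  set w := y - z with hw
  set c : ℕ → ℝ := fun i => inner ℝ (v i) w with hc
  set p := ∑ i ∈ range (m + 1), c i • v i with hp
  set q := ∑ i ∈ range m, c i • v (i + 1) - c m • v 0 with hq
  have hdiff : cyclicShift v m y - cyclicShift v m z = (w - p) + q := by
    have h1 : ∑ i ∈ range m, c i • (v i - v (i + 1))
        = ∑ i ∈ range m, inner ℝ (v i) y • (v i - v (i + 1))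
          - ∑ i ∈ range m, inner ℝ (v i) z • (v i - v (i + 1)) := by
      rw [← sum_sub_distrib]
      exact sum_congr rfl fun i _ => by simp only [hc, hw, inner_sub_right, sub_smul]
    have h2 : c m = inner ℝ (v m) y - inner ℝ (v m) z := inner_sub_right _ _ _
    have h3 : p - q = ∑ i ∈ range m, c i • (v i - v (i + 1)) + c m • (v m + v 0) := by
      simp only [hp, hq, sum_range_succ, smul_sub, sum_sub_distrib]
      module
    rw [show (w - p) + q = w - (p - q) by abel, h3, h1, h2, hw, cyclicShift, cyclicShift,
      partialShift, partialShift]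
    module
  have horth (j : ℕ) (hj : j ≤ m) : inner ℝ (w - p) (v j) = 0 := by
    rw [inner_sub_left, hp, sum_inner, sum_eq_single_of_mem j (mem_range.2 (by omega)),
      real_inner_smul_left, hv j hj j hj, if_pos rfl, mul_one, real_inner_comm, sub_self]
    intro i hi hij
    rw [real_inner_smul_left, hv i (by have := mem_range.1 hi; omega) j hj, if_neg hij, mul_zero]
  have hwp : inner ℝ (w - p) p = 0 := by
    rw [hp, inner_sum, ← hp]
    refine sum_eq_zero fun i hi => ?_
    rw [real_inner_smul_right, horth i (by have := mem_range.1 hi; omega), mul_zero]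
  have hwq : inner ℝ (w - p) q = 0 := by
    rw [hq, inner_sub_right, inner_sum, real_inner_smul_right, horth 0 (by omega), mul_zero,
      sub_zero]
    refine sum_eq_zero fun i hi => ?_
    rw [real_inner_smul_right, horth (i + 1) (by have := mem_range.1 hi; omega), mul_zero]
  have hqn : ‖q‖ ^ 2 = ‖p‖ ^ 2 := by
    have hq' : q = ∑ i ∈ range (m + 1), (if i = 0 then -c m else c (i - 1)) • v i := by
      rw [hq, sum_range_succ']
      simp [sub_eq_add_neg]
    rw [hq', hv.norm_sum_sq, hp, hv.norm_sum_sq, sum_range_succ', sum_range_succ]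
    simp
  have h1 : ‖(w - p) + q‖ ^ 2 = ‖(w - p) + p‖ ^ 2 := by
    rw [norm_add_sq_real, norm_add_sq_real, hwp, hwq, hqn]
  rw [sub_add_cancel] at h1
  rw [hdiff]
  exact (sq_eq_sq₀ (norm_nonneg _) (norm_nonneg _)).1 h1 |>.le

lemma cyclicShift_sum {v : ℕ → EuclideanSpace ℝ (Fin d)} {m : ℕ} (hv : OrthonormalUpTo v m) :
    cyclicShift v m (∑ i ∈ range (m + 1), v i) = ∑ i ∈ range (m + 1), v i := by
  have h1 (i : ℕ) (hi : i ≤ m) : inner ℝ (v i) (∑ j ∈ range (m + 1), v j) = (1 : ℝ) := by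
    rw [inner_sum, sum_eq_single_of_mem i (mem_range.2 (by omega)), hv i hi i hi, if_pos rfl]
    intro j hj hji
    rw [hv i hi j (by have := mem_range.1 hj; omega), if_neg hji.symm]
  have h2 : ∑ i ∈ range m, inner ℝ (v i) (∑ j ∈ range (m + 1), v j) • (v i - v (i + 1))
      = v 0 - v m := by
    rw [← sum_range_sub']
    exact sum_congr rfl fun i hi => by
      rw [h1 i (by have := mem_range.1 hi; omega), one_smul]
  rw [cyclicShift, partialShift, h2, h1 m le_rfl]
  module

/-- The residual of the worst-case operator has a fixed component along the fixed point
`v_0 + ⋯ + v_m`, up to the contribution of the last direction. -/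
lemma inner_residual_cyclicShift {v : ℕ → EuclideanSpace ℝ (Fin d)} {m : ℕ}
    (hv : OrthonormalUpTo v m) (y : EuclideanSpace ℝ (Fin d)) :
    inner ℝ (y - cyclicShift v m y) (∑ i ∈ range (m + 1), v i) = 2 * inner ℝ (v m) y - 2 := by
  have h1 (i : ℕ) (hi : i ≤ m) : inner ℝ (v i) (∑ j ∈ range (m + 1), v j) = (1 : ℝ) := by
    rw [inner_sum, sum_eq_single_of_mem i (mem_range.2 (by omega)), hv i hi i hi, if_pos rfl]
    intro j hj hji
    rw [hv i hi j (by have := mem_range.1 hj; omega), if_neg hji.symm]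
  have h2 : y - cyclicShift v m y = ∑ i ∈ range m, inner ℝ (v i) y • (v i - v (i + 1))
      + inner ℝ (v m) y • (v m + v 0) - (2 : ℝ) • v 0 := by
    rw [cyclicShift, partialShift]
    abel
  rw [h2, inner_sub_left, inner_add_left, sum_inner, sum_eq_zero, real_inner_smul_left,
    inner_add_left, h1 m le_rfl, h1 0 (by omega), real_inner_smul_left, h1 0 (by omega)]
  · ring
  · intro i hi
    have := mem_range.1 hi
    rw [real_inner_smul_left, inner_sub_left, h1 i (by omega), h1 (i + 1) (by omega)]
    ring

/-- Every algorithm started at `0` meets a cyclic shift on `N` directions for which the residual at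
`y_{N-1}` has a component of size at least `2 / √N` along a fixed point of norm `√N`. -/
lemma le_worstCase {N : ℕ} (hN : 2 ≤ N) (hd : 2 * (N - 1) ≤ d) (A : Algorithm d) :
    ENNReal.ofReal (4 / (N : ℝ) ^ 2) ≤ worstCase N A := by
  classical
  obtain ⟨m, rfl⟩ : ∃ m, N = m + 2 := ⟨N - 2, by omega⟩
  obtain ⟨v, hv, hvy⟩ := exists_resisting_directions A m (by omega)
  set y := iter A (partialShift v m) 0 with hy
  -- The last direction need not be orthogonal to the last query: choosing its sign suffices, which
  -- saves one dimension.
  obtain ⟨u, hu, huv, huy, hlast⟩ : ∃ u : EuclideanSpace ℝ (Fin d), ‖u‖ = 1 ∧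
      (∀ i ≤ m, inner ℝ u (v i) = 0) ∧ (∀ k ≤ m, inner ℝ u (y k) = 0) ∧
        inner ℝ u (y (m + 1)) ≤ 0 := by
    obtain ⟨u, hu, hus⟩ := exists_unit_orthogonal
      ((range (m + 1)).image v ∪ (Ioc 0 m).image y) (by
        refine (card_union_le _ _).trans_lt ?_
        have h1 := card_image_le (s := range (m + 1)) (f := v)
        have h2 := card_image_le (s := Ioc 0 m) (f := y)
        rw [card_range] at h1
        rw [Nat.card_Ioc] at h2
        omega)
    have huv : ∀ i ≤ m, inner ℝ u (v i) = 0 := fun i hi =>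
      hus _ (mem_union_left _ (mem_image_of_mem v (mem_range.2 (by omega))))
    have huy : ∀ k ≤ m, inner ℝ u (y k) = 0 := by
      intro k hk
      rcases Nat.eq_zero_or_pos k with rfl | hk0
      · rw [hy, iter, inner_zero_right]
      · exact hus _ (mem_union_right _ (mem_image_of_mem y (mem_Ioc.2 ⟨hk0, hk⟩)))
    rcases le_total (inner ℝ u (y (m + 1))) 0 with h | h
    · exact ⟨u, hu, huv, huy, h⟩
    · refine ⟨-u, by rwa [norm_neg], fun i hi => ?_, fun k hk => ?_, ?_⟩
      · rw [inner_neg_left, huv i hi, neg_zero]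
      · rw [inner_neg_left, huy k hk, neg_zero]
      · rw [inner_neg_left]
        linarith
  set v' := Function.update v (m + 1) u with hv'
  have hon : OrthonormalUpTo v' (m + 1) := hv.update hu huv
  have hvm : v' (m + 1) = u := Function.update_self ..
  set T := cyclicShift v' (m + 1) with hT
  have hit : iter A T 0 (m + 1) = y (m + 1) := by
    refine iter_congr A (fun i hi => ?_) le_rfl
    rw [hT, cyclicShift, hvm, ← hy, huy i (by omega), zero_smul, sub_zero]
    exact partialShift_update (hvy m le_rfl i (by omega))
  set σ := ∑ i ∈ range (m + 2), v' i with hσ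
  have hσn : ‖σ‖ ^ 2 = m + 2 := by
    have h := hon.norm_sum_sq fun _ => 1
    simp only [one_smul, one_pow, sum_const, card_range, nsmul_eq_mul, mul_one] at h
    rw [hσ, h]
    push_cast
    ring
  have hσ0 : (0 : EuclideanSpace ℝ (Fin d)) ≠ σ := by
    intro h
    rw [← h, norm_zero] at hσn
    have : (0 : ℝ) ≤ m := m.cast_nonneg
    nlinarith
  have hres : 4 ≤ ‖y (m + 1) - T (y (m + 1))‖ ^ 2 * ‖σ‖ ^ 2 := by
    have h1 := inner_residual_cyclicShift hon (y (m + 1))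
    rw [hvm] at h1
    have h2 := abs_real_inner_le_norm (y (m + 1) - T (y (m + 1))) σ
    rw [hT, hσ, h1, ← hσ, abs_of_nonpos (by linarith)] at h2
    have h3 : 2 ≤ ‖y (m + 1) - cyclicShift v' (m + 1) (y (m + 1))‖ * ‖σ‖ := by linarith
    rw [← mul_pow, hT]
    nlinarith
  refine le_trans (ENNReal.ofReal_le_ofReal ?_)
    (le_iSup_of_le T <| le_iSup_of_le 0 <| le_iSup_of_le σ <|
      le_iSup_of_le (lipschitzWith_cyclicShift hon) <| le_iSup_of_le (cyclicShift_sum hon) <|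
        le_iSup_of_le hσ0 le_rfl)
  rw [show m + 2 - 1 = m + 1 from rfl, hit, zero_sub, norm_neg, hσn]
  rw [hσn] at hres
  have hm : (0 : ℝ) < (m : ℝ) + 2 := by positivity
  push_cast
  rw [div_le_div_iff₀ (by positivity) hm]
  nlinarith

lemma worstCase_le {N : ℕ} {A : Algorithm d}
    (h : ∀ (T : EuclideanSpace ℝ (Fin d) → EuclideanSpace ℝ (Fin d))
      (y₀ ystar : EuclideanSpace ℝ (Fin d)), LipschitzWith 1 T → T ystar = ystar →
      ‖iter A T y₀ (N - 1) - T (iter A T y₀ (N - 1))‖ ^ 2 ≤ 4 * ‖y₀ - ystar‖ ^ 2 / (N : ℝ) ^ 2) :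
    worstCase N A ≤ ENNReal.ofReal (4 / (N : ℝ) ^ 2) := by
  refine iSup_le fun T => iSup_le fun y₀ => iSup_le fun ystar => iSup_le fun hT =>
    iSup_le fun hfix => iSup_le fun hne => ENNReal.ofReal_le_ofReal ?_
  have hpos : 0 < ‖y₀ - ystar‖ := norm_pos_iff.2 (sub_ne_zero.2 hne)
  rw [div_le_iff₀ (by positivity)]
  exact (h T y₀ ystar hT hfix).trans_eq (by ring)

end

end HMatrix

theorem mainTheorem8 (N N' : ℕ) (hN'₁ : 2 ≤ N') (hN'₂ : N' + 2 ≤ N) :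
    -- the H-certificates are well defined under H-invariance
    (∀ H : Matrix (Fin (N - 1)) (Fin (N - 1)) ℝ, HMatrix.LowerTriangular H →
      HMatrix.HInvariance N H → ∃! lam, HMatrix.IsCertificate N H lam) ∧
    -- sparsity and H-invariance hold exactly for the given values of the Q-functions
    (∀ H : Matrix (Fin (N - 1)) (Fin (N - 1)) ℝ, HMatrix.LowerTriangular H →
      ((HMatrix.HInvariance N H ∧
          (∀ j, 1 ≤ j → j ≤ N' - 1 → HMatrix.BottomSparse N H j) ∧
          (∀ j, N' ≤ j → j ≤ N - 1 → HMatrix.TopSparse N H j)) ↔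
        HMatrix.HasProfile N N' H)) ∧
    -- exactly one H-matrix has these values of the Q-functions
    (∃! H : Matrix (Fin (N - 1)) (Fin (N - 1)) ℝ,
      HMatrix.LowerTriangular H ∧ HMatrix.HasProfile N N' H) ∧
    -- positivity of the remaining H-certificates, and optimality
    (∀ H : Matrix (Fin (N - 1)) (Fin (N - 1)) ℝ, HMatrix.LowerTriangular H →
      HMatrix.HasProfile N N' H →
        (∀ j, 1 ≤ j → j ≤ N' - 1 → 0 < HMatrix.certificate N H N j) ∧
        (∀ j, N' ≤ j → j ≤ N - 1 → 0 < HMatrix.certificate N H (j + 1) j) ∧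
        (∀ (d : ℕ) (T : EuclideanSpace ℝ (Fin d) → EuclideanSpace ℝ (Fin d))
          (y₀ ystar : EuclideanSpace ℝ (Fin d)), LipschitzWith 1 T → T ystar = ystar →
          ‖HMatrix.iter (HMatrix.toAlgorithm H d) T y₀ (N - 1)
              - T (HMatrix.iter (HMatrix.toAlgorithm H d) T y₀ (N - 1))‖ ^ 2
            ≤ 4 * ‖y₀ - ystar‖ ^ 2 / (N : ℝ) ^ 2) ∧
        (∀ d : ℕ, 2 * (N - 1) ≤ d →
          HMatrix.IsMinimaxOptimal N (HMatrix.toAlgorithm H d) ∧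
          HMatrix.worstCase N (HMatrix.toAlgorithm H d)
            = ENNReal.ofReal (4 / (N : ℝ) ^ 2))) := by
  have hcert (H : Matrix (Fin (N - 1)) (Fin (N - 1)) ℝ) (hH : HMatrix.HInvariance N H) {k j : ℕ}
      (hj : 1 ≤ j) (hjk : j < k) (hk : k ≤ N) :
      HMatrix.certificate N H k j = -HMatrix.certMatrix N H k j := by
    rw [HMatrix.certificate_eq_certFormula (by omega) hH, HMatrix.certFormula,
      if_pos ⟨hj, hjk, hk⟩]
  refine ⟨fun H _ hH => ?_, fun H _ => ⟨?_, fun hp => ?_⟩,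
    HMatrix.existsUnique_hasProfile (by omega), fun H _ hp => ?_⟩
  · have h := HMatrix.isCertificate_certFormula (by omega) hH
    exact ⟨_, h, fun lam hlam => hlam.unique h⟩
  · rintro ⟨hH, hbot, htop⟩
    refine HMatrix.hasProfile_of_sparse (by omega) (by omega) (by omega) hH ?_ ?_
    · intro k j hj hjN' hjk hk
      rw [← neg_eq_zero, ← hcert H hH hj hjk hk.le]
      exact hbot j hj (by omega) k hjk (by omega)
    · intro k j hj hjN' hjk hk
      rw [← neg_eq_zero, ← hcert H hH hj (by omega) hk]
      exact htop j hjN' (by omega) k hjk hk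
  · have hH := hp.hInvariance (by omega) (by omega)
    refine ⟨hH, fun j hj hjN' k hjk hk => ?_, fun j hj hjN k hjk hk => ?_⟩
    · rw [hcert H hH hj hjk (by omega), hp.certMatrix_bottom_eq_zero hj (by omega) hjk (by omega),
        neg_zero]
    · rw [hcert H hH (by omega) (by omega) hk,
        hp.certMatrix_top_eq_zero (by omega) hj hjk hk, neg_zero]
  · have hH := hp.hInvariance (by omega) (by omega)
    have hN' : N' ≤ N := by omega
    have hrate (d : ℕ) (T : EuclideanSpace ℝ (Fin d) → EuclideanSpace ℝ (Fin d))
        (y₀ ystar : EuclideanSpace ℝ (Fin d)) (hT : LipschitzWith 1 T) (hfix : T ystar = ystar) :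
        ‖HMatrix.iter (HMatrix.toAlgorithm H d) T y₀ (N - 1)
            - T (HMatrix.iter (HMatrix.toAlgorithm H d) T y₀ (N - 1))‖ ^ 2
          ≤ 4 * ‖y₀ - ystar‖ ^ 2 / (N : ℝ) ^ 2 := by
      refine HMatrix.residual_le_of_certificate (by omega)
        (HMatrix.isCertificate_certFormula (by omega) hH) (fun k j hj hjk hk => ?_) hT hfix
      rw [HMatrix.certFormula, if_pos ⟨hj, hjk, hk⟩, neg_nonneg]
      rcases lt_or_ge j N' with hj' | hj'
      · rcases hk.eq_or_lt with rfl | hk'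
        · exact (hp.certMatrix_bottom_neg hN' hj hj').le
        · exact (hp.certMatrix_bottom_eq_zero hj hj' hjk hk').le
      · rcases (Nat.succ_le_of_lt hjk).eq_or_lt with rfl | hjk'
        · exact (hp.certMatrix_top_neg hN' hj hj' hk).le
        · exact (hp.certMatrix_top_eq_zero hj hj' hjk' hk).le
    refine ⟨fun j hj hjN' => ?_, fun j hj hjN => ?_, hrate, fun d hd => ?_⟩
    · rw [hcert H hH hj (by omega) le_rfl, neg_pos]
      exact hp.certMatrix_bottom_neg hN' hj (by omega)
    · rw [hcert H hH (by omega) (by omega) (by omega), neg_pos]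
      exact hp.certMatrix_top_neg hN' (by omega) hj (by omega)
    · have hle := HMatrix.worstCase_le (hrate d)
      exact ⟨fun B => hle.trans (HMatrix.le_worstCase (by omega) hd B),
        hle.antisymm (HMatrix.le_worstCase (by omega) hd _)⟩
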